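/- Theorem (Classification of simple non-generic domains in the Schwarzschild manifold). Let $n\ge 3$ and $m>0$, and let $(M,g)$ be the Schwarzschild manifold $M=\mathbb{R}^n\setminus\{\mathbf 0\}$, $g=\left(1+\frac{m}{2r^{n-2}}\right)^{\frac{4}{n-2}}\delta$, where $r=|x|$ and $\delta$ is the Euclidean metric. A domain $(\Omega,\Sigma)$ is a non-empty connected open set $\Omega\subset M$ with boundary $\Sigma=\partial\Omega$ in $M$, such that $\Omega\cup\Sigma$ is a complete smooth manifold with boundary $\Sigma$ (near each point of $\Sigma$, $\Omega$ is the set $\{\varphi<0\}$ for a smooth function $\varphi$ with $\varphi=0$ at that point and non-vanishing differential). It is simple if $\Sigma$ is non-empty and connected. It is non-generic if there is a function $u\in C^\infty(\overline\Omega)$ (where $\overline\Omega=\Omega\cup\Sigma$), not identically zero, with $$-(\Delta u)\,g+\operatorname{Hess}u-u\operatorname{Ric}=0\ \text{ in }\Omega,\qquad u_\nu\,\hat g=u\,h\ \text{ on }\Sigma,$$ where $\nu$ is the outward unit normal, $\hat g$ is the induced metric on $\Sigma$, and $h(X,Y)=-\langle\nu,D_XY\rangle$ is the second fundamental form. A simple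 domain $(\Omega,\Sigma)$ in $(M,g)$ is non-generic if and only if $\Sigma$ is of one of the following two types: (i) a Euclidean sphere centered at $\mathbf 0$ of radius $r_+$ or $r_-$, where $r_\pm=\left(\frac{(n-1)\pm\sqrt{n^2-2n}}{2}\,m\right)^{\frac1{n-2}}$; (ii) a Euclidean hyperplane containing $\mathbf 0$ (with the point $\mathbf 0$ removed). Moreover, every hypersurface of type (i) or (ii) is the boundary of a simple non-generic domain. In particular, the boundaries of simple non-generic domains are exactly the hypersurfaces of types (i) and (ii). -/

import Mathlib

open scoped ContDiff

noncomputable section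

namespace StaticBdry

/-! Riemannian geometry of a metric given in one global chart: the manifold is an open set
`M` of `ℝⁿ`, the metric is `g : ℝⁿ → Matrix`, `x ↦ (g_ij(x))`, and only its values on `M` matter.
Tangent vectors at `x` are vectors of `ℝⁿ`. -/

/-- Euclidean `n`-space. -/
abbrev Eu (n : ℕ) : Type := EuclideanSpace ℝ (Fin n)

/-- Matrix-valued functions `x ↦ (g_ij(x))`. -/
abbrev MetricField (n : ℕ) : Type := Eu n → Matrix (Fin n) (Fin n) ℝ

variable {n : ℕ}

/-- The partial derivative `∂_i f (x)`. -/
def pd (i : Fin n) (f : Eu n → ℝ) (x : Eu n) : ℝ :=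
  fderiv ℝ f x (EuclideanSpace.single i 1)

/-- The inner product `g_x(v, w)`. -/
def gInner (g : MetricField n) (x v w : Eu n) : ℝ :=
  ∑ i, ∑ j, g x i j * v i * w j

/-- The Christoffel symbol `Γ^k_{ij}` of the Levi-Civita connection. -/
def christoffel (g : MetricField n) (k i j : Fin n) (x : Eu n) : ℝ :=
  (1 / 2) * ∑ l, (g x)⁻¹ k l *
    (pd i (fun y => g y j l) x + pd j (fun y => g y i l) x - pd l (fun y => g y i j) x)

/-- The covariant derivative `D_X Y` at `x`, for a tangent vector `X` at `x` and a vector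
field `Y`. -/
def covDeriv (g : MetricField n) (x X : Eu n) (Y : Eu n → Eu n) : Eu n :=
  WithLp.toLp 2 fun k =>
    fderiv ℝ (fun y => Y y k) x X + ∑ i, ∑ j, christoffel g k i j x * X i * Y x j

/-- The components of the Hessian, `∂_i ∂_j u - Γ^k_{ij} ∂_k u`. -/
def hess (g : MetricField n) (u : Eu n → ℝ) (i j : Fin n) (x : Eu n) : ℝ :=
  pd i (pd j u) x - ∑ k, christoffel g k i j x * pd k u x

/-- The Laplacian, the `g`-trace of the Hessian. -/
def laplacian (g : MetricField n) (u : Eu n → ℝ) (x : Eu n) : ℝ :=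
  ∑ i, ∑ j, (g x)⁻¹ i j * hess g u i j x

/-- The components of the Ricci tensor (positive on round spheres),
`∂_k Γ^k_{ij} - ∂_j Γ^k_{ik} + Γ^k_{kl} Γ^l_{ij} - Γ^k_{jl} Γ^l_{ik}`. -/
def ricci (g : MetricField n) (i j : Fin n) (x : Eu n) : ℝ :=
  ∑ k, (pd k (christoffel g k i j) x - pd j (christoffel g k i k) x
    + ∑ l, (christoffel g k k l x * christoffel g l i j x
      - christoffel g k j l x * christoffel g l i k x))

/-- The components of `L^* u = -(Δ u) g + Hess u - u Ric`. -/
def staticOp (g : MetricField n) (u : Eu n → ℝ) (i j : Fin n) (x : Eu n) : ℝ :=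
  -(laplacian g u x) * g x i j + hess g u i j x - u x * ricci g i j x

/-- The length of a curve `γ : [0,1] → ℝⁿ` with respect to `g`. -/
def gLength (g : MetricField n) (γ : ℝ → Eu n) : ENNReal :=
  ∫⁻ t in Set.Icc (0 : ℝ) 1, ENNReal.ofReal (√(gInner g (γ t) (deriv γ t) (deriv γ t)))

/-- The intrinsic distance of `S`: the infimum of the `g`-lengths of the `C¹` curves in `S`
from `x` to `y`. -/
def gDist (g : MetricField n) (S : Set (Eu n)) (x y : Eu n) : ENNReal :=
  ⨅ (γ : ℝ → Eu n) (_ : ContDiffOn ℝ 1 γ (Set.Icc 0 1) ∧ γ 0 = x ∧ γ 1 = y ∧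
    ∀ t ∈ Set.Icc (0 : ℝ) 1, γ t ∈ S), gLength g γ

/-- Metric completeness of `S` for the intrinsic distance. -/
def IsGComplete (g : MetricField n) (S : Set (Eu n)) : Prop :=
  ∀ x : ℕ → Eu n, (∀ k, x k ∈ S) →
    (∀ ε : ENNReal, 0 < ε → ∃ N, ∀ k ≥ N, ∀ l ≥ N, gDist g S (x k) (x l) < ε) →
    ∃ p ∈ S, Filter.Tendsto x Filter.atTop (nhds p)

/-- The boundary `Σ = ∂Ω` of `Ω` in the manifold `M`. -/
def bdry (M Ω : Set (Eu n)) : Set (Eu n) := frontier Ω ∩ M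

/-- `φ` is a smooth local defining function of `Ω` at the boundary point `p`: near `p` the
differential of `φ` does not vanish and `Ω` is `{φ < 0}`. -/
def IsDefiningAt (Ω : Set (Eu n)) (p : Eu n) (φ : Eu n → ℝ) : Prop :=
  φ p = 0 ∧ ∃ U : Set (Eu n), IsOpen U ∧ p ∈ U ∧ ContDiffOn ℝ ∞ φ U ∧
    (∀ x ∈ U, fderiv ℝ φ x ≠ 0) ∧ ∀ x ∈ U, x ∈ Ω ↔ φ x < 0

/-- A complete connected smooth domain of `(M, g)`; the last two conditions say that `Ω ∪ ∂Ω` is a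
smooth manifold with boundary `∂Ω` and that it is complete. -/
structure IsSmoothDomain (M : Set (Eu n)) (g : MetricField n) (Ω : Set (Eu n)) : Prop where
  subset : Ω ⊆ M
  isOpen : IsOpen Ω
  isConnected : IsConnected Ω
  smooth_bdry : ∀ p ∈ bdry M Ω, ∃ φ, IsDefiningAt Ω p φ
  complete : IsGComplete g (Ω ∪ bdry M Ω)

/-- The tangent space of `∂Ω` at `p`: the kernel of the differential of a local defining function
(it does not depend on the choice of that function). -/
def bdryTangent (Ω : Set (Eu n)) (p : Eu n) : Set (Eu n) :=
  {X | ∃ φ, IsDefiningAt Ω p φ ∧ fderiv ℝ φ p X = 0}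

/-- `ν` is the outward unit normal to `∂Ω` at `p` with respect to `g`. -/
def IsOutwardUnitNormal (g : MetricField n) (Ω : Set (Eu n)) (p ν : Eu n) : Prop :=
  gInner g p ν ν = 1 ∧ (∀ X ∈ bdryTangent Ω p, gInner g p ν X = 0) ∧
    ∃ φ, IsDefiningAt Ω p φ ∧ 0 < fderiv ℝ φ p ν

/-- `Y` is a smooth vector field near `p` that is tangent to `∂Ω` along `∂Ω`. -/
def IsTangentFieldAt (M Ω : Set (Eu n)) (p : Eu n) (Y : Eu n → Eu n) : Prop :=
  ∃ U : Set (Eu n), IsOpen U ∧ p ∈ U ∧ ContDiffOn ℝ ∞ Y U ∧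
    ∀ q ∈ U ∩ bdry M Ω, Y q ∈ bdryTangent Ω q

/-- The second fundamental form `h(X, Y) = -⟨ν, D_X Y⟩` at `p`, for a tangent vector `X` at `p` and
a tangent field `Y`. -/
def secondFF (g : MetricField n) (p ν X : Eu n) (Y : Eu n → Eu n) : ℝ :=
  -gInner g p ν (covDeriv g p X Y)

/-- `u` is a static potential on `(Ω, ∂Ω)`: a non-trivial function, smooth up to the boundary, with
`-(Δ u) g + Hess u - u Ric = 0` in `Ω` and `u_ν ĝ = u h` on `∂Ω`. -/
structure IsStaticPotential (M : Set (Eu n)) (g : MetricField n) (Ω : Set (Eu n))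
    (u : Eu n → ℝ) : Prop where
  smooth : ContDiffOn ℝ ∞ u (Ω ∪ bdry M Ω)
  nontrivial : ∃ x ∈ Ω ∪ bdry M Ω, u x ≠ 0
  interior_eq : ∀ x ∈ Ω, ∀ i j, staticOp g u i j x = 0
  boundary_eq : ∀ p ∈ bdry M Ω, ∀ ν, IsOutwardUnitNormal g Ω p ν →
    ∀ X ∈ bdryTangent Ω p, ∀ Y, IsTangentFieldAt M Ω p Y →
      fderivWithin ℝ u (Ω ∪ bdry M Ω) p ν * gInner g p X (Y p) = u p * secondFF g p ν X Y

/-- A simple domain: a complete connected smooth domain with exactly one boundary component. -/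
def IsSimpleDomain (M : Set (Eu n)) (g : MetricField n) (Ω : Set (Eu n)) : Prop :=
  IsSmoothDomain M g Ω ∧ IsConnected (bdry M Ω)

/-- A non-generic domain: a complete connected smooth domain that admits a static potential. -/
def IsNonGeneric (M : Set (Eu n)) (g : MetricField n) (Ω : Set (Eu n)) : Prop :=
  IsSmoothDomain M g Ω ∧ ∃ u, IsStaticPotential M g Ω u

/-- The Schwarzschild manifold is `ℝⁿ ∖ {0}`. -/
def punctured (n : ℕ) : Set (Eu n) := {x | x ≠ 0}

/-- The Schwarzschild metric `(1 + m / (2 r^(n-2)))^(4/(n-2)) δ` of mass `m`, for `n ≥ 3`. -/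
def schwarzschild (n : ℕ) (m : ℝ) : MetricField n := fun x i j =>
  (1 + m / (2 * ‖x‖ ^ (n - 2))) ^ (4 / ((n : ℝ) - 2)) * (if i = j then 1 else 0)

/-- The radius `r_+`. -/
def radiusPlus (n : ℕ) (m : ℝ) : ℝ :=
  (((n : ℝ) - 1 + √((n : ℝ) ^ 2 - 2 * n)) / 2 * m) ^ (1 / ((n : ℝ) - 2))

/-- The radius `r_-`. -/
def radiusMinus (n : ℕ) (m : ℝ) : ℝ :=
  (((n : ℝ) - 1 - √((n : ℝ) ^ 2 - 2 * n)) / 2 * m) ^ (1 / ((n : ℝ) - 2))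

/-- `S` is a Euclidean sphere centered at `0` of radius `r_+` or `r_-`. -/
def IsCriticalSphere (m : ℝ) (S : Set (Eu n)) : Prop :=
  S = Metric.sphere (0 : Eu n) (radiusPlus n m) ∨ S = Metric.sphere (0 : Eu n) (radiusMinus n m)

/-- `S` is a Euclidean hyperplane through `0`, as a subset of `ℝⁿ ∖ {0}`. -/
def IsCentralHyperplane (S : Set (Eu n)) : Prop :=
  ∃ a : Eu n, a ≠ 0 ∧ S = {x | inner ℝ a x = 0} ∩ punctured n

end StaticBdry

end

/-!
# Simple non-generic domains in the Schwarzschild manifold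

Write `r = |x|`, `g = e^(2f) δ`, `P = f'/r` (`confP`) and
`V = (r^(n-2) - m/2) / (r^(n-2) + m/2)` (`potV`). The metric is scalar flat, so the static equation
is equivalent to `Hess u = u Ric` (`staticOp_eq_zero_iff`), and `V` is a solution (`hess_potV`).

**The potential is a multiple of `V`.** Off the diagonal, `Hess u = u Ric` reads
`∂_i ∂_j u = P (x_i ∂_j u + x_j ∂_i u) + Q x_i x_j u` with `P`, `Q` radial. Symmetry of the third
derivatives for three distinct indices gives `x_i (x_j ∂_k u - x_k ∂_j u) = 0`, whence the gradient
of `u` is `h x` for a function `h` (`coord_mul_pd_comm`). The remaining equations become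
`∇h = (2 P h + Q u) x` and `h V = u V'/r`. They imply that `h / (V'/r)` is locally constant, and `V'/r` has no zeros, so that no case distinction is needed at the horizon `V = 0`
(`exists_eq_const_mul_potV`).

**The boundary is umbilic.** For `u = V` the boundary condition says
`V dN(X) = (V'/r - V P) ⟨x, N⟩ X` for the Euclidean unit normal `N` and tangent vectors `X`
(`potV_smul_fderiv_unitGrad`). Where `V ≠ 0`, the principal curvature `k(r) ⟨x, N⟩` has vanishing
tangential derivative by the Codazzi equation (`fderiv_eq_zero_of_umbilic`). That derivative is
`⟨x, N⟩ (k'/r + k²) ⟨x, X⟩`, and `k'/r + k²` never vanishes (`hasDerivAt_umbK`). Where `V = 0` the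
equation itself gives `⟨x, N⟩ = 0`. So `x` is tangent or normal to the boundary at every boundary
point (`inner_unitGrad_eq_zero_or_eq_smul`), and `⟨x, N⟩² / r²`, being continuous with values `0` and
`1`, is constant on the connected boundary. If `x` is tangent everywhere, then `N` is constant and
the boundary lies in a hyperplane through the origin; if `x` is normal everywhere, then it lies in a
sphere around the origin, and the equation forces `V² = r² (V'/r)`, which characterises `r_±`
(`potV_sq_eq_iff`). A boundary contained in such a separating hypersurface is all of it
(`bdry_eq_of_subset`).

**Converse.** If the boundary lies in one of these hypersurfaces, differentiating `⟨c, Y⟩ = 0` along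
the boundary, with the normal field `c = x` or `c` constant, shows that `V` satisfies the boundary
condition (`isNonGeneric_of_normal`). The exterior of a sphere and a half-space are complete because
the coordinates and `1/r` are Lipschitz functions for the metric (`isGComplete_of_isClosed`).

Tangential derivatives along a boundary are handled without charts:
`fderiv_apply_eq_zero_of_eq_zero_on_levelSet` and `eventually_eq_of_fderiv_eq_zero_on_levelSet`.
-/

open scoped ContDiff

noncomputable section

namespace StaticBdry

/-! ### Radial functions of the Schwarzschild metric -/

section

/-- The static potential `(r^(n-2) - m/2) / (r^(n-2) + m/2)` as a function of the radius. -/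
def potV (n : ℕ) (m r : ℝ) : ℝ := (r ^ (n - 2) - m / 2) / (r ^ (n - 2) + m / 2)

/-- `f'(r) / r`, where `e^(2f)` is the conformal factor of the Schwarzschild metric. -/
def confP (n : ℕ) (m r : ℝ) : ℝ := -m / (r ^ 2 * (r ^ (n - 2) + m / 2))

/-- `P'(r) / r` for `P = confP`. -/
def confP' (n : ℕ) (m r : ℝ) : ℝ :=
  m * (n * r ^ (n - 2) + m) / (r ^ 4 * (r ^ (n - 2) + m / 2) ^ 2)

/-- `V'(r) / r` for `V = potV`. It is also the coefficient of the Euclidean metric in the Ricci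
tensor. -/
def potV' (n : ℕ) (m r : ℝ) : ℝ :=
  m * (n - 2) * r ^ (n - 2) / (r ^ 2 * (r ^ (n - 2) + m / 2) ^ 2)

/-- The conformal factor `e^(2f)`. -/
def confL (n : ℕ) (m r : ℝ) : ℝ := (1 + m / (2 * r ^ (n - 2))) ^ (4 / ((n : ℝ) - 2))

/-- The coefficient of `x_i x_j` in the Ricci tensor. -/
def ricQ (n : ℕ) (m r : ℝ) : ℝ := -(n - 2) * (confP' n m r - confP n m r ^ 2)

/-- The ratio `(V' / V - f') / r`: where `V ≠ 0`, the boundary of a non-generic domain is umbilic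
with Euclidean principal curvature `umbK · ⟨x, N⟩`. -/
def umbK (n : ℕ) (m r : ℝ) : ℝ :=
  m * ((n - 1) * r ^ (n - 2) - m / 2) / (r ^ 2 * (r ^ (n - 2) - m / 2) * (r ^ (n - 2) + m / 2))

variable {n : ℕ} {m r : ℝ}

lemma hasDerivAt_pow_sub_two (hn : 3 ≤ n) (hr : 0 < r) :
    HasDerivAt (fun r : ℝ => r ^ (n - 2)) ((n - 2) * r ^ (n - 2) / r) r := by
  obtain ⟨k, rfl⟩ := Nat.exists_eq_add_of_le' hn
  have e : k + 3 - 2 = k + 1 := by omega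
  rw [e]
  refine (hasDerivAt_pow (k + 1) r).congr_deriv ?_
  rw [Nat.add_sub_cancel, pow_succ]
  push_cast
  field_simp
  ring

lemma hasDerivAt_potV (hn : 3 ≤ n) (hm : 0 < m) (hr : 0 < r) :
    HasDerivAt (potV n m) (potV' n m r * r) r := by
  have ht := hasDerivAt_pow_sub_two hn hr
  have hp : 0 < r ^ (n - 2) := by positivity
  have h := (ht.sub_const (m / 2)).div (ht.add_const (m / 2)) (by positivity)
  refine h.congr_deriv ?_
  unfold potV'
  generalize r ^ (n - 2) = t at *
  have : t + m / 2 ≠ 0 := by positivity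
  have : t * 2 + m ≠ 0 := by positivity
  field_simp
  ring

lemma hasDerivAt_confP (hn : 3 ≤ n) (hm : 0 < m) (hr : 0 < r) :
    HasDerivAt (confP n m) (confP' n m r * r) r := by
  have ht := hasDerivAt_pow_sub_two hn hr
  have hp : 0 < r ^ (n - 2) := by positivity
  have h := (hasDerivAt_const r (-m)).div ((hasDerivAt_pow 2 r).mul (ht.add_const (m / 2)))
    (mul_ne_zero (by positivity) (by positivity))
  refine h.congr_deriv ?_
  unfold confP'
  simp only [Pi.mul_apply]
  generalize r ^ (n - 2) = t at *
  have : t + m / 2 ≠ 0 := by positivity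
  have : t * 2 + m ≠ 0 := by positivity
  field_simp
  norm_num
  ring

lemma confL_pos (hm : 0 < m) (hr : 0 < r) : 0 < confL n m r := by
  unfold confL; positivity

lemma hasDerivAt_confL (hn : 3 ≤ n) (hm : 0 < m) (hr : 0 < r) :
    HasDerivAt (confL n m) (2 * confP n m r * confL n m r * r) r := by
  have ht := hasDerivAt_pow_sub_two hn hr
  have hp : 0 < r ^ (n - 2) := by positivity
  have hw : 0 < 1 + m / (2 * r ^ (n - 2)) := by positivity
  have h := (((hasDerivAt_const r m).div (ht.const_mul 2) (by positivity)).const_add 1).rpow_const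
    (p := 4 / ((n : ℝ) - 2)) (Or.inl hw.ne')
  refine h.congr_deriv ?_
  have h2 : (n : ℝ) - 2 ≠ 0 := by
    have : (3 : ℝ) ≤ n := by exact_mod_cast hn
    linarith
  simp only [Pi.div_apply]
  rw [Real.rpow_sub_one hw.ne']
  unfold confP confL
  generalize (1 + m / (2 * r ^ (n - 2))) ^ (4 / ((n : ℝ) - 2)) = W at *
  generalize r ^ (n - 2) = t at *
  have : t + m / 2 ≠ 0 := by positivity
  have : t * 2 + m ≠ 0 := by positivity
  field_simp
  ring

/-- The pair `(V, V'/r)` solves the linear system satisfied by a radial potential `u` and the factor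
`h` in `∇u = h x`. -/
lemma hasDerivAt_potV' (hn : 3 ≤ n) (hm : 0 < m) (hr : 0 < r) :
    HasDerivAt (potV' n m) ((2 * confP n m r * potV' n m r + ricQ n m r * potV n m r) * r) r := by
  have ht := hasDerivAt_pow_sub_two hn hr
  have hp : 0 < r ^ (n - 2) := by positivity
  have h := (ht.const_mul (m * (n - 2))).div
    ((hasDerivAt_pow 2 r).mul ((ht.add_const (m / 2)).pow 2))
    (mul_ne_zero (by positivity) (pow_ne_zero 2 (by positivity)))
  refine h.congr_deriv ?_
  unfold confP potV' potV ricQ confP confP'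
  simp only [Pi.mul_apply, Pi.pow_apply]
  generalize r ^ (n - 2) = t at *
  have : t + m / 2 ≠ 0 := by positivity
  have : t * 2 + m ≠ 0 := by positivity
  field_simp
  norm_num
  ring

lemma potV'_pos (hn : 3 ≤ n) (hm : 0 < m) (hr : 0 < r) : 0 < potV' n m r := by
  have : (3 : ℝ) ≤ n := by exact_mod_cast hn
  have : (0 : ℝ) < n - 2 := by linarith
  unfold potV'; positivity

lemma one_add_confP_mul (hm : 0 < m) (hr : 0 < r) :
    1 + confP n m r * r ^ 2 = potV n m r := by
  have hp : 0 < r ^ (n - 2) := by positivity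
  unfold confP potV
  generalize r ^ (n - 2) = t at *
  have : t + m / 2 ≠ 0 := by positivity
  have : t * 2 + m ≠ 0 := by positivity
  field_simp
  ring

/-- The coefficient of the Euclidean metric in the Ricci tensor of `e^(2f) δ`. -/
lemma potV'_eq (hm : 0 < m) (hr : 0 < r) :
    -(n - 2) * confP n m r - (n * confP n m r + confP' n m r * r ^ 2)
      - (n - 2) * (confP n m r ^ 2 * r ^ 2) = potV' n m r := by
  have hp : 0 < r ^ (n - 2) := by positivity
  unfold confP confP' potV'
  generalize r ^ (n - 2) = t at *
  have : t + m / 2 ≠ 0 := by positivity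
  have : t * 2 + m ≠ 0 := by positivity
  field_simp
  ring

/-- The scalar curvature vanishes. -/
lemma ricQ_trace (hm : 0 < m) (hr : 0 < r) :
    ricQ n m r * r ^ 2 + n * potV' n m r = 0 := by
  have hp : 0 < r ^ (n - 2) := by positivity
  unfold ricQ confP confP' potV'
  generalize r ^ (n - 2) = t at *
  have : t + m / 2 ≠ 0 := by positivity
  have : t * 2 + m ≠ 0 := by positivity
  field_simp
  ring

/-- The nonvanishing that forces static potentials to be radial. -/
lemma confP_sq_add_ricQ_ne_zero (hn : 3 ≤ n) (hm : 0 < m) (hr : 0 < r) :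
    confP n m r ^ 2 + ricQ n m r - confP' n m r ≠ 0 := by
  have hp : 0 < r ^ (n - 2) := by positivity
  have h3 : (3 : ℝ) ≤ n := by exact_mod_cast hn
  have : confP n m r ^ 2 + ricQ n m r - confP' n m r
      = -(m * n * (n - 1) * r ^ (n - 2) / (r ^ 4 * (r ^ (n - 2) + m / 2) ^ 2)) := by
    unfold ricQ confP confP'
    generalize r ^ (n - 2) = t at *
    have : t + m / 2 ≠ 0 := by positivity
    have : t * 2 + m ≠ 0 := by positivity
    field_simp
    ring
  rw [this]
  have : (0 : ℝ) < n - 1 := by linarith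
  have : (0 : ℝ) < n := by linarith
  have : 0 < m * n * (n - 1) * r ^ (n - 2) / (r ^ 4 * (r ^ (n - 2) + m / 2) ^ 2) := by positivity
  linarith

lemma potV_eq_zero_iff (hm : 0 < m) (hr : 0 < r) : potV n m r = 0 ↔ r ^ (n - 2) = m / 2 := by
  have hp : 0 < r ^ (n - 2) := by positivity
  unfold potV
  rw [div_eq_zero_iff, sub_eq_zero, or_iff_left (by positivity)]

lemma potV_mul_umbK (hm : 0 < m) (hr : 0 < r) (hV : potV n m r ≠ 0) :
    potV n m r * umbK n m r = potV' n m r - potV n m r * confP n m r := by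
  have hp : 0 < r ^ (n - 2) := by positivity
  have h := (potV_eq_zero_iff hm hr).not.1 hV
  unfold umbK potV potV' confP
  generalize r ^ (n - 2) = t at *
  have : t + m / 2 ≠ 0 := by positivity
  have : t * 2 + m ≠ 0 := by positivity
  have : t - m / 2 ≠ 0 := sub_ne_zero.2 h
  have : t * 2 - m ≠ 0 := fun h' => this (by linarith)
  field_simp
  ring

/-- Where `V ≠ 0`, the coefficient of the Codazzi equation of an umbilic boundary does not
vanish. -/
lemma hasDerivAt_umbK (hn : 3 ≤ n) (hm : 0 < m) (hr : 0 < r) (hV : potV n m r ≠ 0) :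
    ∃ k', HasDerivAt (umbK n m) (k' * r) r ∧ k' + umbK n m r ^ 2 ≠ 0 := by
  have ht := hasDerivAt_pow_sub_two hn hr
  have hp : 0 < r ^ (n - 2) := by positivity
  have h := (potV_eq_zero_iff hm hr).not.1 hV
  have h0 : r ^ (n - 2) - m / 2 ≠ 0 := sub_ne_zero.2 h
  have h0' : r ^ (n - 2) * 2 - m ≠ 0 := fun h' => h0 (by linarith)
  have h0'' : 2 * r ^ (n - 2) - m ≠ 0 := fun h' => h0 (by linarith)
  have h1 : r ^ (n - 2) + m / 2 ≠ 0 := by positivity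
  have h1'' : 2 * r ^ (n - 2) + m ≠ 0 := by positivity
  have h1' : r ^ (n - 2) * 2 + m ≠ 0 := by positivity
  have hd := (((ht.const_mul ((n : ℝ) - 1)).sub_const (m / 2)).const_mul m).div
    (((hasDerivAt_pow 2 r).mul (ht.sub_const (m / 2))).mul (ht.add_const (m / 2)))
    (mul_ne_zero (mul_ne_zero (by positivity) h0) h1)
  have h3 : (3 : ℝ) ≤ n := by exact_mod_cast hn
  have hn1 : (0 : ℝ) < n - 1 := by linarith
  have hn0 : (0 : ℝ) < n := by linarith
  refine ⟨-(m * n * (n - 1) * r ^ (n - 2) / (r ^ 4 * (r ^ (n - 2) + m / 2) ^ 2))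
    - umbK n m r ^ 2, hd.congr_deriv ?_, ?_⟩
  · unfold umbK
    simp only [Pi.mul_apply]
    generalize r ^ (n - 2) = t at *
    field_simp
    norm_num
    ring
  · have : 0 < m * n * (n - 1) * r ^ (n - 2) / (r ^ 4 * (r ^ (n - 2) + m / 2) ^ 2) := by positivity
    rw [sub_add_cancel]
    linarith

end

/-! ### Curvature of the Schwarzschild metric -/

section

variable {n : ℕ} {m : ℝ}

lemma hasFDerivAt_radial {h : ℝ → ℝ} {a : ℝ} {x : Eu n} (hx : x ≠ 0)
    (hh : HasDerivAt h (a * ‖x‖) ‖x‖) :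
    HasFDerivAt (fun y : Eu n => h ‖y‖) (a • innerSL ℝ x) x := by
  have h1 : HasFDerivAt (fun y : Eu n => ‖y‖) (‖x‖⁻¹ • innerSL ℝ x) x := by
    have := (hasStrictFDerivAt_norm_sq x).hasFDerivAt.sqrt (by positivity)
    simp only [Real.sqrt_sq (norm_nonneg _)] at this
    refine this.congr_fderiv ?_
    ext v
    simp
    field_simp
  refine (hh.comp_hasFDerivAt x h1).congr_fderiv ?_
  rw [smul_smul]
  congr 1
  field_simp

lemma hasFDerivAt_coord (i : Fin n) (x : Eu n) :
    HasFDerivAt (fun y : Eu n => y i) (EuclideanSpace.proj i : Eu n →L[ℝ] ℝ) x :=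
  (EuclideanSpace.proj i : Eu n →L[ℝ] ℝ).hasFDerivAt

lemma pd_radial {h : ℝ → ℝ} {a : ℝ} {x : Eu n} (hx : x ≠ 0)
    (hh : HasDerivAt h (a * ‖x‖) ‖x‖) (i : Fin n) :
    pd i (fun y : Eu n => h ‖y‖) x = a * x i := by
  rw [pd, (hasFDerivAt_radial hx hh).fderiv]
  simp [EuclideanSpace.inner_single_right]

lemma schwarzschild_eq (x : Eu n) :
    schwarzschild n m x = confL n m ‖x‖ • (1 : Matrix (Fin n) (Fin n) ℝ) := by
  ext i j
  simp [schwarzschild, confL, Matrix.one_apply]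

lemma schwarzschild_inv (hm : 0 < m) {x : Eu n} (hx : x ≠ 0) :
    (schwarzschild n m x)⁻¹ = (confL n m ‖x‖)⁻¹ • (1 : Matrix (Fin n) (Fin n) ℝ) := by
  rw [schwarzschild_eq]
  refine Matrix.inv_eq_right_inv ?_
  have := (confL_pos (n := n) hm (norm_pos_iff.2 hx)).ne'
  simp [smul_smul, this]

lemma pd_schwarzschild (hn : 3 ≤ n) (hm : 0 < m) {x : Eu n} (hx : x ≠ 0) (i j k : Fin n) :
    pd i (fun y => schwarzschild n m y j k) x
      = if j = k then 2 * confP n m ‖x‖ * confL n m ‖x‖ * x i else 0 := by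
  simp only [schwarzschild_eq, Matrix.smul_apply, Matrix.one_apply, smul_eq_mul]
  split_ifs with h
  · simp only [mul_one]
    exact pd_radial hx (hasDerivAt_confL hn hm (norm_pos_iff.2 hx)) i
  · simp [pd]

lemma christoffel_schwarzschild (hn : 3 ≤ n) (hm : 0 < m) {x : Eu n} (hx : x ≠ 0)
    (k i j : Fin n) :
    christoffel (schwarzschild n m) k i j x
      = (if k = i then confP n m ‖x‖ * x j else 0) + (if k = j then confP n m ‖x‖ * x i else 0)
        - (if i = j then confP n m ‖x‖ * x k else 0) := by
  have h0 := (confL_pos (n := n) hm (norm_pos_iff.2 hx)).ne'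
  simp only [christoffel, schwarzschild_inv hm hx, pd_schwarzschild hn hm hx, Matrix.smul_apply,
    Matrix.one_apply, smul_eq_mul, mul_ite, mul_one, mul_zero, ite_mul, zero_mul,
    Finset.sum_ite_eq, Finset.mem_univ, if_true]
  simp only [eq_comm (a := j), eq_comm (a := i) (b := k)]
  split_ifs <;> field_simp <;> ring

lemma eventually_ne_zero {x : Eu n} (hx : x ≠ 0) : ∀ᶠ y in nhds x, y ≠ 0 :=
  isOpen_ne.mem_nhds hx

lemma pd_congr {f g : Eu n → ℝ} {x : Eu n} (h : f =ᶠ[nhds x] g) (i : Fin n) :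
    pd i f x = pd i g x := by
  rw [pd, pd, h.fderiv_eq]

lemma hasFDerivAt_confP_mul_coord (hn : 3 ≤ n) (hm : 0 < m) {x : Eu n} (hx : x ≠ 0)
    (j : Fin n) :
    HasFDerivAt (fun y : Eu n => confP n m ‖y‖ * y j)
      (confP n m ‖x‖ • (EuclideanSpace.proj j : Eu n →L[ℝ] ℝ)
        + x j • confP' n m ‖x‖ • innerSL ℝ x) x :=
  (hasFDerivAt_radial hx (hasDerivAt_confP hn hm (norm_pos_iff.2 hx))).mul (hasFDerivAt_coord j x)

/-- The components of the Euclidean Hessian of the logarithmic conformal factor. -/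
lemma pd_confP_mul_coord (hn : 3 ≤ n) (hm : 0 < m) {x : Eu n} (hx : x ≠ 0) (i j : Fin n) :
    pd i (fun y : Eu n => confP n m ‖y‖ * y j) x
      = confP' n m ‖x‖ * x i * x j + if i = j then confP n m ‖x‖ else 0 := by
  rw [pd, (hasFDerivAt_confP_mul_coord hn hm hx j).fderiv]
  simp [EuclideanSpace.inner_single_right, eq_comm (a := j)]
  ring

lemma pd_christoffel (hn : 3 ≤ n) (hm : 0 < m) {x : Eu n} (hx : x ≠ 0) (l k i j : Fin n) :
    pd l (christoffel (schwarzschild n m) k i j) x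
      = (if k = i then pd l (fun y : Eu n => confP n m ‖y‖ * y j) x else 0)
        + (if k = j then pd l (fun y : Eu n => confP n m ‖y‖ * y i) x else 0)
        - (if i = j then pd l (fun y : Eu n => confP n m ‖y‖ * y k) x else 0) := by
  have he : christoffel (schwarzschild n m) k i j =ᶠ[nhds x] fun y =>
      (if k = i then (1 : ℝ) else 0) * (confP n m ‖y‖ * y j)
        + (if k = j then 1 else 0) * (confP n m ‖y‖ * y i)
        - (if i = j then 1 else 0) * (confP n m ‖y‖ * y k) := by
    filter_upwards [eventually_ne_zero hx] with y hy
    rw [christoffel_schwarzschild hn hm hy]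
    simp
  have hd := hasFDerivAt_confP_mul_coord hn hm hx
  rw [pd_congr he, pd, ((((hd j).const_mul _).fun_add ((hd i).const_mul _)).fun_sub
    ((hd k).const_mul _)).fderiv]
  simp only [pd, (hd _).fderiv]
  split_ifs <;> simp

lemma sum_coord_sq (x : Eu n) : ∑ i, x i * x i = ‖x‖ ^ 2 := by
  rw [EuclideanSpace.norm_sq_eq]
  simp [sq]

/-- The Christoffel symbols of `e^(2f) δ`, for a covector `a = df`. -/
def confGamma (a : Fin n → ℝ) (k i j : Fin n) : ℝ :=
  (if k = i then a j else 0) + (if k = j then a i else 0) - (if i = j then a k else 0)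

lemma sum_confGamma_trace (a : Fin n → ℝ) (i : Fin n) :
    ∑ k, confGamma a k i k = n * a i := by
  have : ∀ k, confGamma a k i k = a i := by
    intro k
    simp only [confGamma]
    by_cases h : k = i
    · subst h; simp
    · simp [h, Ne.symm h]
  simp [this]

lemma sum_confGamma_trace' (a : Fin n → ℝ) (i : Fin n) :
    ∑ k, confGamma a k k i = n * a i := by
  rw [← sum_confGamma_trace]
  refine Finset.sum_congr rfl fun k _ => ?_
  simp only [confGamma, eq_comm (a := k) (b := i)]
  ring

lemma sum_mul_confGamma (a b : Fin n → ℝ) (i j : Fin n) :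
    ∑ k, b k * confGamma a k i j
      = b i * a j + b j * a i - if i = j then ∑ k, b k * a k else 0 := by
  simp only [confGamma, mul_add, mul_sub, Finset.sum_add_distrib, Finset.sum_sub_distrib, mul_ite,
    mul_zero, Finset.sum_ite_eq', Finset.mem_univ, if_true]
  split_ifs <;> simp

lemma sum_confGamma_mul (a : Fin n → ℝ) (i j : Fin n) :
    ∑ k, ∑ l, confGamma a k j l * confGamma a l i k
      = (n + 2) * (a i * a j) - 2 * if i = j then ∑ k, a k * a k else 0 := by
  have h : ∀ k, ∑ l, confGamma a k j l * confGamma a l i k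
      = confGamma a k j i * a k + confGamma a k j k * a i
        - if i = k then ∑ l, confGamma a k j l * a l else 0 := fun k => sum_mul_confGamma _ _ _ _
  simp only [h, Finset.sum_sub_distrib, Finset.sum_add_distrib, Finset.sum_ite_eq,
    Finset.mem_univ, if_true, ← Finset.sum_mul, sum_confGamma_trace]
  have h1 := sum_mul_confGamma a a j i
  simp only [mul_comm (a _) (confGamma _ _ _ _)] at h1
  have h2 : ∑ l, confGamma a i j l * a l = (if i = j then ∑ k, a k * a k else 0) := by
    simp only [confGamma, add_mul, sub_mul, ite_mul, zero_mul, Finset.sum_add_distrib,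
      Finset.sum_sub_distrib, Finset.sum_ite_eq, Finset.mem_univ, if_true]
    split_ifs <;> simp [mul_comm]
  rw [h1, h2]
  simp only [eq_comm (a := j) (b := i)]
  ring

lemma ricci_schwarzschild (hn : 3 ≤ n) (hm : 0 < m) {x : Eu n} (hx : x ≠ 0) (i j : Fin n) :
    ricci (schwarzschild n m) i j x
      = ricQ n m ‖x‖ * x i * x j + if i = j then potV' n m ‖x‖ else 0 := by
  have hs := sum_coord_sq x
  have hq := potV'_eq (n := n) hm (norm_pos_iff.2 hx)
  have hG : ∀ k i j, christoffel (schwarzschild n m) k i j x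
      = confGamma (fun i => confP n m ‖x‖ * x i) k i j :=
    fun k i j => christoffel_schwarzschild hn hm hx k i j
  have hD : ∀ l k i j, pd l (christoffel (schwarzschild n m) k i j) x
      = confGamma (fun j => pd l (fun y : Eu n => confP n m ‖y‖ * y j) x) k i j :=
    fun l k i j => pd_christoffel hn hm hx l k i j
  have hS1 : ∑ k, confGamma (fun j => pd k (fun y : Eu n => confP n m ‖y‖ * y j) x) k i j
      = 2 * pd i (fun y : Eu n => confP n m ‖y‖ * y j) x
        - if i = j then n * confP n m ‖x‖ + confP' n m ‖x‖ * ‖x‖ ^ 2 else 0 := by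
    simp only [confGamma, Finset.sum_sub_distrib, Finset.sum_add_distrib, Finset.sum_ite_eq',
      Finset.mem_univ, if_true]
    simp only [pd_confP_mul_coord hn hm hx, if_true, eq_comm (a := j) (b := i)]
    rw [← hs]
    split_ifs <;> simp [Finset.sum_add_distrib, Finset.mul_sum] <;> ring_nf
  simp only [ricci, Finset.sum_add_distrib, Finset.sum_sub_distrib, hD, hG]
  rw [hS1, sum_confGamma_mul, sum_confGamma_trace, Finset.sum_comm]
  simp only [← Finset.sum_mul, sum_confGamma_trace']
  have h3 := sum_mul_confGamma (fun i => confP n m ‖x‖ * x i)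
    (fun l => n * (confP n m ‖x‖ * x l)) i j
  rw [h3]
  simp only [pd_confP_mul_coord hn hm hx, ricQ, eq_comm (a := j) (b := i)]
  have h4 : ∑ k, confP n m ‖x‖ * x k * (confP n m ‖x‖ * x k) = confP n m ‖x‖ ^ 2 * ‖x‖ ^ 2 := by
    rw [← hs, Finset.mul_sum]
    exact Finset.sum_congr rfl fun k _ => by ring
  have h5 : ∑ k, n * (confP n m ‖x‖ * x k) * (confP n m ‖x‖ * x k)
      = n * (confP n m ‖x‖ ^ 2 * ‖x‖ ^ 2) := by
    rw [← h4, Finset.mul_sum]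
    exact Finset.sum_congr rfl fun k _ => by ring
  rw [h4, h5, ← hq]
  split_ifs <;> ring

lemma trace_ricci_schwarzschild (hn : 3 ≤ n) (hm : 0 < m) {x : Eu n} (hx : x ≠ 0) :
    ∑ i, ricci (schwarzschild n m) i i x = 0 := by
  simp only [ricci_schwarzschild hn hm hx, if_true, Finset.sum_add_distrib, mul_assoc,
    ← Finset.mul_sum, sum_coord_sq]
  simp [ricQ_trace hm (norm_pos_iff.2 hx)]

lemma hess_schwarzschild (hn : 3 ≤ n) (hm : 0 < m) {x : Eu n} (hx : x ≠ 0) (u : Eu n → ℝ)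
    (i j : Fin n) :
    hess (schwarzschild n m) u i j x
      = pd i (pd j u) x - confP n m ‖x‖ * (x i * pd j u x + x j * pd i u x)
        + if i = j then confP n m ‖x‖ * ∑ k, x k * pd k u x else 0 := by
  have h := sum_mul_confGamma (fun i => confP n m ‖x‖ * x i) (fun k => pd k u x) i j
  have hG : ∀ k i j, christoffel (schwarzschild n m) k i j x
      = confGamma (fun i => confP n m ‖x‖ * x i) k i j :=
    fun k i j => christoffel_schwarzschild hn hm hx k i j
  simp only [hess, hG, mul_comm (confGamma _ _ _ _)]
  rw [h]
  have h5 : ∑ k, pd k u x * (confP n m ‖x‖ * x k) = confP n m ‖x‖ * ∑ k, x k * pd k u x := by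
    rw [Finset.mul_sum]
    exact Finset.sum_congr rfl fun k _ => by ring
  rw [h5]
  split_ifs <;> ring

lemma laplacian_schwarzschild (hm : 0 < m) {x : Eu n} (hx : x ≠ 0) (u : Eu n → ℝ) :
    laplacian (schwarzschild n m) u x
      = (confL n m ‖x‖)⁻¹ * ∑ i, hess (schwarzschild n m) u i i x := by
  simp [laplacian, schwarzschild_inv hm hx, Matrix.one_apply, Finset.mul_sum]

/-- Since the scalar curvature vanishes, the static equation says `Hess u = u Ric`. -/
lemma staticOp_eq_zero_iff (hn : 3 ≤ n) (hm : 0 < m) {x : Eu n} (hx : x ≠ 0) (u : Eu n → ℝ) :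
    (∀ i j, staticOp (schwarzschild n m) u i j x = 0) ↔
      ∀ i j, hess (schwarzschild n m) u i j x = u x * ricci (schwarzschild n m) i j x := by
  have hL := (confL_pos (n := n) hm (norm_pos_iff.2 hx)).ne'
  have hR := trace_ricci_schwarzschild hn hm hx
  have h3 : (3 : ℝ) ≤ n := by exact_mod_cast hn
  have hlap := laplacian_schwarzschild hm hx u
  constructor
  · intro h
    have h1 : ∑ i, staticOp (schwarzschild n m) u i i x = 0 := Finset.sum_eq_zero fun i _ => h i i
    simp only [staticOp, Finset.sum_sub_distrib, Finset.sum_add_distrib, ← Finset.mul_sum, hR,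
      schwarzschild_eq, Matrix.smul_apply, Matrix.one_apply_eq, hlap] at h1
    simp only [Finset.sum_const, Finset.card_univ, Fintype.card_fin, nsmul_eq_mul, smul_eq_mul,
      mul_one, mul_zero, sub_zero] at h1
    have h2 : (1 - (n : ℝ)) * ∑ i, hess (schwarzschild n m) u i i x = 0 := by
      rw [← h1]; field_simp; ring
    have h4 : ∑ i, hess (schwarzschild n m) u i i x = 0 :=
      (mul_eq_zero.1 h2).resolve_left (by linarith)
    intro i j
    have := h i j
    rw [staticOp, hlap, h4] at this
    linarith
  · intro h i j
    have h4 : ∑ i, hess (schwarzschild n m) u i i x = 0 := by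
      simp only [h, ← Finset.mul_sum, hR, mul_zero]
    rw [staticOp, hlap, h4, h i j]
    ring

end

/-! ### Static potentials of the Schwarzschild metric -/

section

variable {n : ℕ} {m : ℝ}

lemma pd_mul {f g : Eu n → ℝ} {x : Eu n} (hf : DifferentiableAt ℝ f x)
    (hg : DifferentiableAt ℝ g x) (i : Fin n) :
    pd i (fun y => f y * g y) x = f x * pd i g x + pd i f x * g x := by
  simp only [pd]
  rw [fderiv_fun_mul hf hg]
  simp
  ring

lemma pd_add {f g : Eu n → ℝ} {x : Eu n} (hf : DifferentiableAt ℝ f x)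
    (hg : DifferentiableAt ℝ g x) (i : Fin n) :
    pd i (fun y => f y + g y) x = pd i f x + pd i g x := by
  simp only [pd]
  rw [fderiv_fun_add hf hg]
  simp

lemma pd_coord (i j : Fin n) (x : Eu n) :
    pd i (fun y : Eu n => y j) x = if j = i then 1 else 0 := by
  rw [pd, (hasFDerivAt_coord j x).fderiv]
  simp

lemma contDiffOn_pd {u : Eu n → ℝ} {Ω : Set (Eu n)} (hΩ : IsOpen Ω) (hu : ContDiffOn ℝ ∞ u Ω)
    (i : Fin n) : ContDiffOn ℝ ∞ (pd i u) Ω := by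
  have := hu.fderiv_of_isOpen hΩ (m := ∞) (by simp)
  exact this.clm_apply contDiffOn_const

lemma differentiableAt_of_contDiffOn {F : Type*} [NormedAddCommGroup F] [NormedSpace ℝ F]
    {u : Eu n → F} {Ω : Set (Eu n)} (hΩ : IsOpen Ω)
    (hu : ContDiffOn ℝ ∞ u Ω) {x : Eu n} (hx : x ∈ Ω) : DifferentiableAt ℝ u x :=
  (hu.contDiffAt (hΩ.mem_nhds hx)).differentiableAt (by simp)

lemma pd_comm {u : Eu n → ℝ} {Ω : Set (Eu n)} (hΩ : IsOpen Ω) (hu : ContDiffOn ℝ ∞ u Ω)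
    {x : Eu n} (hx : x ∈ Ω) (i j : Fin n) : pd i (pd j u) x = pd j (pd i u) x := by
  have hd : DifferentiableAt ℝ (fderiv ℝ u) x :=
    differentiableAt_of_contDiffOn hΩ (hu.fderiv_of_isOpen hΩ (m := ∞) (by simp)) hx
  have hs : IsSymmSndFDerivAt ℝ u x :=
    (hu.contDiffAt (hΩ.mem_nhds hx)).isSymmSndFDerivAt
      (by rw [minSmoothness_of_isRCLikeNormedField]; exact WithTop.coe_le_coe.2 le_top)
  have h : ∀ i j, pd i (pd j u) x = fderiv ℝ (fderiv ℝ u) x (EuclideanSpace.single i 1)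
      (EuclideanSpace.single j 1) := by
    intro i j
    change fderiv ℝ (fun y => fderiv ℝ u y (EuclideanSpace.single j 1)) x _ = _
    rw [fderiv_clm_apply hd (differentiableAt_const _)]
    simp
  rw [h, h, hs]

lemma fderiv_eq_zero_of_pd {f : Eu n → ℝ} {x : Eu n} (h : ∀ i, pd i f x = 0) :
    fderiv ℝ f x = 0 := by
  ext v
  have hv : v = ∑ i, v i • EuclideanSpace.single i (1 : ℝ) := by
    simpa using! ((EuclideanSpace.basisFun (Fin n) ℝ).sum_repr v).symm
  rw [hv, map_sum]
  refine Finset.sum_eq_zero fun i _ => ?_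
  rw [map_smul]
  have := h i
  rw [pd] at this
  rw [this, smul_zero]

/-- A continuous function that vanishes off the coordinate hyperplane `x_i = 0` vanishes. -/
lemma eq_zero_of_eq_zero_of_coord_ne_zero {f : Eu n → ℝ} {Ω : Set (Eu n)} (hΩ : IsOpen Ω)
    (hf : ContinuousOn f Ω) (i : Fin n) (h : ∀ x ∈ Ω, x i ≠ 0 → f x = 0) {x : Eu n}
    (hx : x ∈ Ω) : f x = 0 := by
  by_cases hi : x i = 0
  swap
  · exact h x hx hi
  set γ : ℝ → Eu n := fun t => x + t • EuclideanSpace.single i 1 with hγ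
  have hγc : Filter.Tendsto γ (nhdsWithin 0 {0}ᶜ) (nhds x) := by
    have : Continuous γ := by fun_prop
    have h0 : γ 0 = x := by simp [hγ]
    have := this.tendsto 0
    rw [h0] at this
    exact this.mono_left nhdsWithin_le_nhds
  have h1 : Filter.Tendsto (fun t => f (γ t)) (nhdsWithin 0 {0}ᶜ) (nhds (f x)) :=
    ((hf.continuousAt (hΩ.mem_nhds hx)).tendsto).comp hγc
  have h2 : (fun t => f (γ t)) =ᶠ[nhdsWithin 0 {0}ᶜ] fun _ => 0 := by
    filter_upwards [hγc (hΩ.mem_nhds hx), self_mem_nhdsWithin] with t ht ht0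
    refine h _ ht ?_
    simpa [hγ, hi] using ht0
  exact tendsto_nhds_unique (h1.congr' h2) tendsto_const_nhds

lemma pd_potV (hn : 3 ≤ n) (hm : 0 < m) {x : Eu n} (hx : x ≠ 0) (i : Fin n) :
    pd i (fun y : Eu n => potV n m ‖y‖) x = potV' n m ‖x‖ * x i :=
  pd_radial hx (hasDerivAt_potV hn hm (norm_pos_iff.2 hx)) i

lemma hess_potV (hn : 3 ≤ n) (hm : 0 < m) {x : Eu n} (hx : x ≠ 0) (i j : Fin n) :
    hess (schwarzschild n m) (fun y => potV n m ‖y‖) i j x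
      = potV n m ‖x‖ * ricci (schwarzschild n m) i j x := by
  have hr := norm_pos_iff.2 hx
  have he : pd j (fun y : Eu n => potV n m ‖y‖) =ᶠ[nhds x] fun y => potV' n m ‖y‖ * y j := by
    filter_upwards [eventually_ne_zero hx] with y hy using pd_potV hn hm hy j
  have hV' := hasFDerivAt_radial hx (hasDerivAt_potV' hn hm hr)
  rw [hess_schwarzschild hn hm hx, ricci_schwarzschild hn hm hx, pd_congr he,
    pd_mul hV'.differentiableAt (hasFDerivAt_coord j x).differentiableAt, pd_coord,
    pd_radial hx (hasDerivAt_potV' hn hm hr)]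
  simp only [pd_potV hn hm hx]
  have h5 : ∑ k, x k * (potV' n m ‖x‖ * x k) = potV' n m ‖x‖ * ‖x‖ ^ 2 := by
    rw [← sum_coord_sq, Finset.mul_sum]
    exact Finset.sum_congr rfl fun k _ => by ring
  rw [h5]
  simp only [eq_comm (a := j) (b := i)]
  have := one_add_confP_mul (n := n) hm hr
  split_ifs
  · linear_combination potV' n m ‖x‖ * this
  · ring

section Uniqueness

variable {Ω : Set (Eu n)} {u : Eu n → ℝ}

lemma exists_hasDerivAt_ricQ (hm : 0 < m) {r : ℝ} (hr : 0 < r) :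
    ∃ a, HasDerivAt (ricQ n m) (a * r) r := by
  have hd : DifferentiableAt ℝ (ricQ n m) r := by
    unfold ricQ confP confP'
    have h1 : r ^ 4 * (r ^ (n - 2) + m / 2) ^ 2 ≠ 0 := by positivity
    have h2 : r ^ 2 * (r ^ (n - 2) + m / 2) ≠ 0 := by positivity
    fun_prop (disch := assumption)
  exact ⟨deriv (ricQ n m) r / r, hd.hasDerivAt.congr_deriv (by field_simp)⟩

/-- The integrability condition of the off-diagonal equations
`∂_i ∂_j u = P (x_i ∂_j u + x_j ∂_i u) + Q x_i x_j u` forces the angular derivatives of `u` to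
vanish. -/
lemma coord_mul_pd_comm (hn : 3 ≤ n) (hm : 0 < m) (hΩ : IsOpen Ω) (h0 : Ω ⊆ punctured n)
    (hu : ContDiffOn ℝ ∞ u Ω)
    (hoff : ∀ x ∈ Ω, ∀ i j, i ≠ j → pd i (pd j u) x
      = confP n m ‖x‖ * (x i * pd j u x + x j * pd i u x) + ricQ n m ‖x‖ * (x i * x j * u x))
    {x : Eu n} (hx : x ∈ Ω) (j k : Fin n) : x j * pd k u x = x k * pd j u x := by
  by_cases hjk : j = k
  · rw [hjk]
  obtain ⟨i, hij, hik⟩ : ∃ i : Fin n, i ≠ j ∧ i ≠ k := by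
    have : ({j, k} : Finset (Fin n)).card < Fintype.card (Fin n) := by
      have := Finset.card_le_two (a := j) (b := k)
      simp; omega
    obtain ⟨i, hi⟩ := Finset.exists_mem_notMem_of_card_lt_card
      (s := {j, k}) (t := Finset.univ) (by simpa using this)
    exact ⟨i, by simpa using hi⟩
  have hpd := fun i => contDiffOn_pd hΩ hu i
  have key : ∀ x ∈ Ω, x i ≠ 0 → x j * pd k u x - x k * pd j u x = 0 := by
    intro x hx hxi
    have hx0 : x ≠ 0 := h0 hx
    have hr := norm_pos_iff.2 hx0
    obtain ⟨a, ha⟩ := exists_hasDerivAt_ricQ (n := n) hm hr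
    have hP := hasDerivAt_confP hn hm hr
    have hdP := (hasFDerivAt_radial hx0 hP).differentiableAt
    have hdQ := (hasFDerivAt_radial hx0 ha).differentiableAt
    have hdu := differentiableAt_of_contDiffOn hΩ hu hx
    have hdpu := fun i => differentiableAt_of_contDiffOn hΩ (hpd i) hx
    have hdc := fun i => (hasFDerivAt_coord (n := n) i x).differentiableAt
    -- The third derivative of `u` in three different directions.
    have third : ∀ j k, i ≠ j → i ≠ k → j ≠ k → pd k (pd i (pd j u)) x
        = confP' n m ‖x‖ * x k * (x i * pd j u x + x j * pd i u x)
          + confP n m ‖x‖ * (x i * pd k (pd j u) x + x j * pd k (pd i u) x)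
          + a * x k * (x i * x j * u x) + ricQ n m ‖x‖ * (x i * x j * pd k u x) := by
      intro j k hij hik hjk
      have he : pd i (pd j u) =ᶠ[nhds x] fun y =>
          confP n m ‖y‖ * (y i * pd j u y + y j * pd i u y)
            + ricQ n m ‖y‖ * (y i * y j * u y) := by
        filter_upwards [hΩ.mem_nhds hx] with y hy using hoff y hy i j hij
      have h1 := (hdc i).fun_mul (hdpu j)
      have h2 := (hdc j).fun_mul (hdpu i)
      have h3 := (hdc i).fun_mul (hdc j)
      rw [pd_congr he, pd_add (hdP.fun_mul (h1.fun_add h2)) (hdQ.fun_mul (h3.fun_mul hdu)),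
        pd_mul hdP (h1.fun_add h2), pd_mul hdQ (h3.fun_mul hdu), pd_add h1 h2, pd_mul (hdc i) (hdpu j),
        pd_mul (hdc j) (hdpu i), pd_mul h3 hdu, pd_mul (hdc i) (hdc j), pd_coord, pd_coord,
        pd_radial hx0 hP, pd_radial hx0 ha, if_neg hik, if_neg hjk]
      ring
    have hsym : pd k (pd i (pd j u)) x = pd j (pd i (pd k u)) x := by
      rw [pd_comm hΩ (hpd j) hx, pd_comm hΩ (hpd k) hx]
      refine pd_congr ?_ i
      filter_upwards [hΩ.mem_nhds hx] with y hy using pd_comm hΩ hu hy k j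
    rw [third j k hij hik hjk, third k j hik hij (Ne.symm hjk), hoff x hx k j (Ne.symm hjk),
      hoff x hx k i (Ne.symm hik), hoff x hx j k hjk, hoff x hx j i (Ne.symm hij)] at hsym
    have hne := confP_sq_add_ricQ_ne_zero hn hm hr
    have : (x j * pd k u x - x k * pd j u x)
        * (x i * (confP n m ‖x‖ ^ 2 + ricQ n m ‖x‖ - confP' n m ‖x‖)) = 0 := by
      linear_combination hsym
    exact (mul_eq_zero.1 this).resolve_right (mul_ne_zero hxi hne)
  have hc : ContinuousOn (fun x : Eu n => x j * pd k u x - x k * pd j u x) Ω := by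
    have h1 := (hpd k).continuousOn
    have h2 := (hpd j).continuousOn
    fun_prop
  exact sub_eq_zero.1 (eq_zero_of_eq_zero_of_coord_ne_zero hΩ hc i key hx)

/-- On a connected open set the static potentials are the multiples of `potV`. -/
lemma exists_eq_const_mul_potV (hn : 3 ≤ n) (hm : 0 < m) (hΩ : IsOpen Ω) (h0 : Ω ⊆ punctured n)
    (hc : IsPreconnected Ω) (hu : ContDiffOn ℝ ∞ u Ω)
    (hst : ∀ x ∈ Ω, ∀ i j, staticOp (schwarzschild n m) u i j x = 0) :
    ∃ C, ∀ x ∈ Ω, u x = C * potV n m ‖x‖ := by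
  have heq : ∀ x ∈ Ω, ∀ i j, pd i (pd j u) x
      = confP n m ‖x‖ * (x i * pd j u x + x j * pd i u x) + ricQ n m ‖x‖ * (x i * x j * u x)
        + if i = j then potV' n m ‖x‖ * u x - confP n m ‖x‖ * ∑ k, x k * pd k u x else 0 := by
    intro x hx i j
    have h := (staticOp_eq_zero_iff hn hm (h0 hx) u).1 (hst x hx) i j
    rw [hess_schwarzschild hn hm (h0 hx), ricci_schwarzschild hn hm (h0 hx)] at h
    split_ifs at h ⊢ <;> linear_combination h
  have hoff : ∀ x ∈ Ω, ∀ i j, i ≠ j → pd i (pd j u) x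
      = confP n m ‖x‖ * (x i * pd j u x + x j * pd i u x)
        + ricQ n m ‖x‖ * (x i * x j * u x) := by
    intro x hx i j hij
    rw [heq x hx, if_neg hij, add_zero]
  have hpd := fun i => contDiffOn_pd hΩ hu i
  -- The gradient of `u` is `h x`.
  set h : Eu n → ℝ := fun x => (∑ k, x k * pd k u x) / ‖x‖ ^ 2 with hh
  have hnz : ∀ x ∈ Ω, ‖x‖ ^ 2 ≠ 0 := fun x hx => by
    have := norm_pos_iff.2 (show x ≠ 0 from h0 hx)
    positivity
  have hgrad : ∀ x ∈ Ω, ∀ k, pd k u x = h x * x k := by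
    intro x hx k
    have : ∑ j, x j * pd j u x * x k = pd k u x * ‖x‖ ^ 2 := by
      rw [← sum_coord_sq, Finset.mul_sum]
      refine Finset.sum_congr rfl fun j _ => ?_
      linear_combination x j * coord_mul_pd_comm hn hm hΩ h0 hu hoff hx k j
    rw [← Finset.sum_mul] at this
    simp only [hh]
    rw [div_mul_eq_mul_div, this, mul_div_assoc, div_self (hnz x hx), mul_one]
  have hcoord : ∀ k, ContDiffOn ℝ ∞ (fun x : Eu n => x k) Ω := fun k =>
    (EuclideanSpace.proj k : Eu n →L[ℝ] ℝ).contDiff.contDiffOn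
  have hhs : ContDiffOn ℝ ∞ h Ω :=
    (ContDiffOn.sum fun k _ => (hcoord k).mul (hpd k)).div (contDiff_norm_sq ℝ).contDiffOn hnz
  have hmul : ∀ x ∈ Ω, ∀ i j, pd i (pd j u) x = h x * (if j = i then 1 else 0) + pd i h x * x j := by
    intro x hx i j
    have he : pd j u =ᶠ[nhds x] fun y => h y * y j := by
      filter_upwards [hΩ.mem_nhds hx] with y hy using hgrad y hy j
    rw [pd_congr he, pd_mul (differentiableAt_of_contDiffOn hΩ hhs hx)
      (hasFDerivAt_coord j x).differentiableAt, pd_coord]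
  have hsum : ∀ x ∈ Ω, ∑ k, x k * pd k u x = h x * ‖x‖ ^ 2 := fun x hx => by
    simp only [hh]; rw [div_mul_cancel₀ _ (hnz x hx)]
  have hhd : ∀ x ∈ Ω, ∀ i, pd i h x
      = (2 * confP n m ‖x‖ * h x + ricQ n m ‖x‖ * u x) * x i := by
    intro x hx i
    obtain ⟨j, hj⟩ : ∃ j : Fin n, j ≠ i := by
      have : Nontrivial (Fin n) := Fin.nontrivial_iff_two_le.2 (by omega)
      exact exists_ne i
    have key : ∀ x ∈ Ω, x j ≠ 0 →
        pd i h x - (2 * confP n m ‖x‖ * h x + ricQ n m ‖x‖ * u x) * x i = 0 := by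
      intro x hx hxj
      have h1 := hmul x hx i j
      rw [hoff x hx i j hj.symm, if_neg hj, hgrad x hx, hgrad x hx] at h1
      have : x j * (pd i h x - (2 * confP n m ‖x‖ * h x + ricQ n m ‖x‖ * u x) * x i) = 0 := by
        linear_combination -h1
      exact (mul_eq_zero.1 this).resolve_left hxj
    have hcont : ContinuousOn (fun x : Eu n =>
        pd i h x - (2 * confP n m ‖x‖ * h x + ricQ n m ‖x‖ * u x) * x i) Ω := by
      have h1 := (contDiffOn_pd hΩ hhs i).continuousOn
      have h2 := hhs.continuousOn
      have h3 := hu.continuousOn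
      have h4 : ContinuousOn (fun x : Eu n => confP n m ‖x‖) Ω := fun x hx =>
        (hasFDerivAt_radial (h0 hx) (hasDerivAt_confP hn hm
          (norm_pos_iff.2 (h0 hx)))).continuousAt.continuousWithinAt
      have h5 : ContinuousOn (fun x : Eu n => ricQ n m ‖x‖) Ω := fun x hx => by
        obtain ⟨a, ha⟩ := exists_hasDerivAt_ricQ (n := n) hm (norm_pos_iff.2 (h0 hx))
        exact (hasFDerivAt_radial (h0 hx) ha).continuousAt.continuousWithinAt
      fun_prop
    exact sub_eq_zero.1 (eq_zero_of_eq_zero_of_coord_ne_zero hΩ hcont j key hx)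
  have hVh : ∀ x ∈ Ω, h x * potV n m ‖x‖ = potV' n m ‖x‖ * u x := by
    intro x hx
    let i : Fin n := ⟨0, by omega⟩
    have h1 := hmul x hx i i
    rw [heq x hx, if_pos rfl, if_pos rfl, hgrad x hx, hhd x hx, hsum x hx] at h1
    rw [← one_add_confP_mul hm (norm_pos_iff.2 (h0 hx))]
    linear_combination -h1
  have hρd : ∀ x ∈ Ω, DifferentiableAt ℝ (fun x : Eu n => (potV' n m ‖x‖)⁻¹) x := fun x hx =>
    ((hasFDerivAt_radial (h0 hx) (hasDerivAt_potV' hn hm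
      (norm_pos_iff.2 (h0 hx)))).differentiableAt).fun_inv
      (potV'_pos hn hm (norm_pos_iff.2 (h0 hx))).ne'
  have hρ : ∀ x ∈ Ω, ∀ i, pd i (fun x : Eu n => (potV' n m ‖x‖)⁻¹) x
      = -((2 * confP n m ‖x‖ * potV' n m ‖x‖ + ricQ n m ‖x‖ * potV n m ‖x‖) * x i
        / potV' n m ‖x‖ ^ 2) := by
    intro x hx i
    have hr := norm_pos_iff.2 (h0 hx)
    have hd := (hasDerivAt_potV' hn hm hr).fun_inv (potV'_pos hn hm hr).ne'
    have hd' := hd.congr_deriv (f' := _) (g' := (-(2 * confP n m ‖x‖ * potV' n m ‖x‖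
      + ricQ n m ‖x‖ * potV n m ‖x‖) / potV' n m ‖x‖ ^ 2) * ‖x‖) (by ring)
    rw [pd_radial (h0 hx) hd']
    ring
  obtain ⟨C, hC⟩ := hΩ.exists_is_const_of_fderiv_eq_zero hc
    (f := fun x => h x * (potV' n m ‖x‖)⁻¹) (𝕜 := ℝ)
    (fun x hx => ((differentiableAt_of_contDiffOn hΩ hhs hx).fun_mul
      (hρd x hx)).differentiableWithinAt)
    (fun x hx => by
      refine fderiv_eq_zero_of_pd fun i => ?_
      have hp := (potV'_pos hn hm (norm_pos_iff.2 (h0 hx))).ne'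
      rw [pd_mul (differentiableAt_of_contDiffOn hΩ hhs hx) (hρd x hx), hρ x hx, hhd x hx]
      field_simp
      linear_combination (-ricQ n m ‖x‖ * x i) * hVh x hx)
  refine ⟨C, fun x hx => ?_⟩
  have hp := (potV'_pos hn hm (norm_pos_iff.2 (h0 hx))).ne'
  have h1 : h x * (potV' n m ‖x‖)⁻¹ = C := hC x hx
  rw [← div_eq_mul_inv, div_eq_iff hp] at h1
  have h2 := hVh x hx
  rw [h1] at h2
  exact mul_left_cancel₀ hp (by linear_combination -h2)

end Uniqueness

end

/-! ### Calculus on level sets -/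

section

open Filter Topology

section LevelSets

variable {E F : Type*} [NormedAddCommGroup E] [NormedSpace ℝ E]
  [NormedAddCommGroup F] [NormedSpace ℝ F]

/-- A function that vanishes on a regular level set has vanishing tangential derivative. By
Lagrange multipliers: every component of the function is extremal on the level set. -/
lemma fderiv_apply_eq_zero_of_eq_zero_on_levelSet [CompleteSpace E]
    {θ : E → ℝ} {G : E → F} {p v : E}
    (hθ : ContDiffAt ℝ 1 θ p) (hd : fderiv ℝ θ p ≠ 0) (h0 : θ p = 0)
    (hG : ContDiffAt ℝ 1 G p) (h : ∀ᶠ x in 𝓝 p, θ x = 0 → G x = 0)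
    (hv : fderiv ℝ θ p v = 0) : fderiv ℝ G p v = 0 := by
  refine SeparatingDual.eq_zero_of_forall_dual_eq_zero (R := ℝ) fun l => ?_
  have hGp : G p = 0 := h.self_of_nhds h0
  have hext : IsLocalExtrOn (fun x => l (G x)) {x | θ x = θ p} p := by
    left
    filter_upwards [nhdsWithin_le_nhds h, self_mem_nhdsWithin] with x hx hx0
    rw [hx (by rw [show θ x = θ p from hx0, h0]), hGp]
  have hGs := hG.hasStrictFDerivAt (one_ne_zero)
  obtain ⟨a, b, hab, hsum⟩ := hext.exists_multipliers_of_hasStrictFDerivAt_1d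
    (hθ.hasStrictFDerivAt one_ne_zero) (l.hasStrictFDerivAt.comp p hGs)
  have hb : b ≠ 0 := by
    rintro rfl
    have ha : a ≠ 0 := by rintro rfl; exact hab rfl
    rw [zero_smul, add_zero] at hsum
    exact hd ((smul_eq_zero.1 hsum).resolve_left ha)
  have := congrArg (fun L : E →L[ℝ] ℝ => L v) hsum
  simp only [add_apply, smul_apply, hv, zero_apply, smul_eq_mul, mul_zero, zero_add,
    ContinuousLinearMap.comp_apply] at this
  exact (mul_eq_zero.1 this).resolve_left hb

/-- A function whose tangential derivative vanishes along a regular level set is locally constant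
on it. The level set is flattened by the local diffeomorphism
`x ↦ (x - p) + (θ x - θ'(p) (x - p)) w` with `θ'(p) w = 1`. -/
lemma eventually_eq_of_fderiv_eq_zero_on_levelSet [CompleteSpace E]
    {θ : E → ℝ} {G : E → F} {U : Set E} {p : E}
    (hU : IsOpen U) (hp : p ∈ U) (hθ : ContDiffOn ℝ ∞ θ U) (hd : fderiv ℝ θ p ≠ 0) (h0 : θ p = 0)
    (hG : ∀ x ∈ U, DifferentiableAt ℝ G x)
    (h : ∀ x ∈ U, θ x = 0 → ∀ v, fderiv ℝ θ x v = 0 → fderiv ℝ G x v = 0) :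
    ∀ᶠ x in 𝓝 p, θ x = 0 → G x = G p := by
  set L := fderiv ℝ θ p with hL
  obtain ⟨w, hw⟩ : ∃ w, L w = 1 := by
    obtain ⟨v, hv⟩ : ∃ v, L v ≠ 0 := by
      by_contra! hcon
      exact hd (ContinuousLinearMap.ext hcon)
    exact ⟨(L v)⁻¹ • v, by rw [map_smul, smul_eq_mul, inv_mul_cancel₀ hv]⟩
  have hθp : ContDiffAt ℝ ∞ θ p := hθ.contDiffAt (hU.mem_nhds hp)
  set Φ : E → E := fun x => (x - p) + (θ x - L (x - p)) • w with hΦ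
  have hΦs : ContDiffAt ℝ ∞ Φ p := by
    have : ContDiffAt ℝ ∞ (fun x => L (x - p)) p :=
      L.contDiff.contDiffAt.comp p (contDiffAt_id.sub contDiffAt_const)
    exact (contDiffAt_id.sub contDiffAt_const).add ((hθp.sub this).smul contDiffAt_const)
  have hΦd : HasFDerivAt Φ ((ContinuousLinearEquiv.refl ℝ E : E ≃L[ℝ] E) : E →L[ℝ] E) p := by
    have h1 : HasFDerivAt (fun x => x - p) (ContinuousLinearMap.id ℝ E) p :=
      (hasFDerivAt_id p).sub_const p
    have h2 : HasFDerivAt θ L p := (hθp.differentiableAt (by simp)).hasFDerivAt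
    refine (h1.add ((h2.sub (L.hasFDerivAt.comp p h1)).smul_const w)).congr_fderiv ?_
    ext v
    simp
  have hLΦ : ∀ x, L (Φ x) = θ x := by
    intro x
    simp only [hΦ, map_add, map_smul, hw, smul_eq_mul, mul_one]
    ring
  have hΦp : Φ p = 0 := by simp [hΦ, h0]
  have hne : (∞ : WithTop ℕ∞) ≠ 0 := by simp
  have hstr := hΦs.hasStrictFDerivAt' hΦd hne
  set ψ := hΦs.localInverse hΦd hne with hψ
  have hψ0 : ψ 0 = p := by
    have := hΦs.localInverse_apply_image hΦd hne
    rwa [hΦp] at this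
  have hψs : ContDiffAt ℝ ∞ ψ 0 := by
    have := hΦs.to_localInverse hΦd hne
    rwa [hΦp] at this
  have hright : ∀ᶠ y in 𝓝 (0 : E), Φ (ψ y) = y := by
    have := hstr.eventually_right_inverse
    rwa [hΦp] at this
  have hleft : ∀ᶠ x in 𝓝 p, ψ (Φ x) = x := hstr.eventually_left_inverse
  have hψU : ∀ᶠ y in 𝓝 (0 : E), ψ y ∈ U := by
    have := hψs.continuousAt
    rw [ContinuousAt, hψ0] at this
    exact this (hU.mem_nhds hp)
  have hψd : ∀ᶠ y in 𝓝 (0 : E), DifferentiableAt ℝ ψ y := by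
    filter_upwards [(hψs.of_le (m := 1) (by exact_mod_cast le_top)).eventually (by simp)] with y hy
      using hy.differentiableAt one_ne_zero
  obtain ⟨ε, hε, hball⟩ := Metric.eventually_nhds_iff_ball.1 (hright.and (hψU.and hψd))
  have hflat : ∀ y ∈ Metric.ball (0 : E) ε, L y = 0 → G (ψ y) = G p := by
    intro y hy hLy
    have hmem : ∀ s ∈ Set.Icc (0 : ℝ) 1, s • y ∈ Metric.ball (0 : E) ε := by
      intro s hs
      rw [mem_ball_zero_iff] at hy ⊢
      calc ‖s • y‖ = s * ‖y‖ := by rw [norm_smul, Real.norm_of_nonneg hs.1]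
        _ ≤ 1 * ‖y‖ := by gcongr; exact hs.2
        _ < ε := by rwa [one_mul]
    have hlin : ∀ s : ℝ, HasDerivAt (fun s : ℝ => s • y) y s := fun s => by
      simpa using (hasDerivAt_id s).smul_const y
    have hder : ∀ s ∈ Set.Icc (0 : ℝ) 1, HasDerivAt (fun s : ℝ => G (ψ (s • y))) 0 s := by
      intro s hs
      obtain ⟨h1, h2, h3⟩ := hball _ (hmem s hs)
      have hc : HasDerivAt (fun s : ℝ => ψ (s • y)) (fderiv ℝ ψ (s • y) y) s :=
        h3.hasFDerivAt.comp_hasDerivAt s (hlin s)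
      have hθd : HasDerivAt (fun s : ℝ => θ (ψ (s • y)))
          (fderiv ℝ θ (ψ (s • y)) (fderiv ℝ ψ (s • y) y)) s :=
        (((hθ.contDiffAt (hU.mem_nhds h2)).differentiableAt hne).hasFDerivAt).comp_hasDerivAt s hc
      have hθ0 : (fun s : ℝ => θ (ψ (s • y))) =ᶠ[𝓝 s] fun _ => 0 := by
        have hcont : ContinuousAt (fun s : ℝ => s • y) s := (hlin s).continuousAt
        filter_upwards [hcont (Metric.isOpen_ball.mem_nhds (hmem s hs))] with a ha
        rw [← hLΦ, (hball _ ha).1, map_smul, hLy, smul_zero]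
      have hzero := hθd.unique ((hasDerivAt_const s (0 : ℝ)).congr_of_eventuallyEq hθ0)
      have := (hG _ h2).hasFDerivAt.comp_hasDerivAt s hc
      rwa [h _ h2 hθ0.self_of_nhds _ hzero] at this
    have := constant_of_has_deriv_right_zero (f := fun s : ℝ => G (ψ (s • y)))
      (fun s hs => (hder s hs).continuousAt.continuousWithinAt)
      (fun s hs => (hder s ⟨hs.1, hs.2.le⟩).hasDerivWithinAt) 1 (by simp)
    simpa [hψ0] using this
  have hΦc : ∀ᶠ x in 𝓝 p, Φ x ∈ Metric.ball (0 : E) ε := by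
    have := hΦs.continuousAt
    rw [ContinuousAt, hΦp] at this
    exact this (Metric.ball_mem_nhds 0 hε)
  filter_upwards [hleft, hΦc] with x hx1 hx2 hx3
  rw [← hflat _ hx2 (by rw [hLΦ, hx3]), hx1]

/-- Two nonzero functionals with compatible negative half-spaces are positive multiples of each
other. -/
lemma exists_pos_smul_eq_of_neg_imp_nonpos {L₁ L₂ : E →L[ℝ] ℝ} (h₁ : L₁ ≠ 0) (h₂ : L₂ ≠ 0)
    (h : ∀ v, L₁ v < 0 → L₂ v ≤ 0) : ∃ c : ℝ, 0 < c ∧ L₂ = c • L₁ := by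
  obtain ⟨w, hw⟩ : ∃ w, L₁ w = -1 := by
    obtain ⟨v, hv⟩ : ∃ v, L₁ v ≠ 0 := by
      by_contra! hcon
      exact h₁ (ContinuousLinearMap.ext hcon)
    exact ⟨-(L₁ v)⁻¹ • v, by rw [map_smul, smul_eq_mul, neg_mul, inv_mul_cancel₀ hv]⟩
  have hker' : ∀ v, L₁ v = 0 → L₂ v ≤ 0 := by
    intro v hv
    have hlim : Tendsto (fun ε : ℝ => L₂ v + ε * L₂ w) (𝓝[>] 0) (𝓝 (L₂ v + 0 * L₂ w)) := by
      refine Tendsto.mono_left ?_ nhdsWithin_le_nhds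
      exact Continuous.tendsto (by fun_prop) 0
    rw [zero_mul, add_zero] at hlim
    refine le_of_tendsto hlim ?_
    filter_upwards [self_mem_nhdsWithin] with ε hε
    have := h (v + ε • w) (by rw [map_add, map_smul, hv, hw]; simpa using hε)
    simpa using this
  have hker : ∀ v, L₁ v = 0 → L₂ v = 0 := fun v hv =>
    le_antisymm (hker' v hv) (by simpa using hker' (-v) (by simp [hv]))
  have heq : L₂ = (-L₂ w) • L₁ := by
    ext v
    have := hker (v + L₁ v • w) (by rw [map_add, map_smul, hw]; simp)
    rw [map_add, map_smul, smul_eq_mul] at this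
    simp only [smul_apply, smul_eq_mul]
    linarith
  refine ⟨-L₂ w, lt_of_le_of_ne ?_ ?_, heq⟩
  · linarith [h w (by rw [hw]; norm_num)]
  · intro h0
    rw [← h0, zero_smul] at heq
    exact h₂ heq

end LevelSets

end

/-! ### The boundary of a smooth domain -/

section

open Filter Topology

variable {n : ℕ} {M Ω U : Set (Eu n)} {p : Eu n} {φ : Eu n → ℝ}

/-- `φ` is a regular defining function of `Ω` on the open set `U`. -/
structure DefiningOn (Ω U : Set (Eu n)) (φ : Eu n → ℝ) : Prop where
  isOpen : IsOpen U
  smooth : ContDiffOn ℝ ∞ φ U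
  regular : ∀ x ∈ U, fderiv ℝ φ x ≠ 0
  mem_iff : ∀ x ∈ U, x ∈ Ω ↔ φ x < 0

lemma isDefiningAt_iff :
    IsDefiningAt Ω p φ ↔ φ p = 0 ∧ ∃ U, p ∈ U ∧ DefiningOn Ω U φ := by
  constructor
  · rintro ⟨h0, U, h1, h2, h3, h4, h5⟩
    exact ⟨h0, U, h2, h1, h3, h4, h5⟩
  · rintro ⟨h0, U, h2, h1, h3, h4, h5⟩
    exact ⟨h0, U, h1, h2, h3, h4, h5⟩

/-- The Euclidean unit normal of the level sets of `φ`. -/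
def unitGrad (φ : Eu n → ℝ) (x : Eu n) : Eu n := ‖gradient φ x‖⁻¹ • gradient φ x

lemma inner_unitGrad (φ : Eu n → ℝ) (x v : Eu n) :
    inner ℝ (unitGrad φ x) v = ‖gradient φ x‖⁻¹ * fderiv ℝ φ x v := by
  rw [unitGrad, real_inner_smul_left, inner_gradient_left]

lemma gradient_ne_zero {x : Eu n} (h : fderiv ℝ φ x ≠ 0) : gradient φ x ≠ 0 := by
  simpa [gradient] using h

lemma norm_unitGrad {x : Eu n} (h : fderiv ℝ φ x ≠ 0) : ‖unitGrad φ x‖ = 1 := by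
  have := norm_ne_zero_iff.2 (gradient_ne_zero h)
  rw [unitGrad, norm_smul, norm_inv, norm_norm, inv_mul_cancel₀ this]

lemma exists_neg_of_ne_zero {L : Eu n →L[ℝ] ℝ} (h : L ≠ 0) : ∃ v, L v < 0 := by
  by_contra! hcon
  refine h (ContinuousLinearMap.ext fun v => le_antisymm ?_ (hcon v))
  simpa using hcon (-v)

namespace DefiningOn

lemma contDiffOn_unitGrad (hD : DefiningOn Ω U φ) : ContDiffOn ℝ ∞ (unitGrad φ) U := by
  have h1 : ContDiffOn ℝ ∞ (gradient φ) U :=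
    (InnerProductSpace.toDual ℝ (Eu n)).symm.contDiff.comp_contDiffOn
      (hD.smooth.fderiv_of_isOpen hD.isOpen (by simp))
  have h0 := fun x hx => gradient_ne_zero (hD.regular x hx)
  exact ((h1.norm ℝ h0).inv fun x hx => norm_ne_zero_iff.2 (h0 x hx)).smul h1

lemma inner_unitGrad_eq_zero_iff (hD : DefiningOn Ω U φ) (hp : p ∈ U) (v : Eu n) :
    inner ℝ (unitGrad φ p) v = 0 ↔ fderiv ℝ φ p v = 0 := by
  rw [inner_unitGrad, mul_eq_zero, or_iff_right]
  exact inv_ne_zero (norm_ne_zero_iff.2 (gradient_ne_zero (hD.regular p hp)))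

lemma hasFDerivAt (hD : DefiningOn Ω U φ) (hp : p ∈ U) : HasFDerivAt φ (fderiv ℝ φ p) p :=
  (differentiableAt_of_contDiffOn hD.isOpen hD.smooth hp).hasFDerivAt

/-- A ray pointing into `{φ < 0}` starts inside the domain. -/
lemma eventually_add_smul_mem (hD : DefiningOn Ω U φ) (hp : p ∈ U) (h0 : φ p = 0) {v : Eu n}
    (hv : fderiv ℝ φ p v < 0) : ∀ᶠ t : ℝ in 𝓝[>] 0, p + t • v ∈ Ω := by
  have hline : HasDerivAt (fun t : ℝ => p + t • v) v 0 := by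
    simpa using ((hasDerivAt_id (0 : ℝ)).smul_const v).const_add p
  have hline0 : p + (0 : ℝ) • v = p := by simp
  have hd : HasDerivAt (fun t : ℝ => φ (p + t • v)) (fderiv ℝ φ p v) 0 := by
    have h1 := hD.hasFDerivAt hp
    rw [← hline0] at h1
    simpa using! h1.comp_hasDerivAt (0 : ℝ) hline
  have hU : ∀ᶠ t : ℝ in 𝓝[>] 0, p + t • v ∈ U := by
    refine nhdsWithin_le_nhds (hline.continuousAt ?_)
    rw [hline0]
    exact hD.isOpen.mem_nhds hp
  have hslope := (hasDerivAt_iff_tendsto_slope.1 hd).mono_left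
    (nhdsWithin_mono (0 : ℝ) (s := Set.Ioi 0) (fun t ht => (ne_of_gt ht : t ≠ 0)))
  filter_upwards [hU, hslope.eventually_lt_const hv, self_mem_nhdsWithin] with t h1 h2 h3
  rw [hD.mem_iff _ h1]
  have ht : (0 : ℝ) < t := h3
  rw [slope_def_field, hline0, h0, sub_zero, sub_zero, div_lt_iff₀ ht, zero_mul] at h2
  exact h2

lemma mem_closure (hD : DefiningOn Ω U φ) (hp : p ∈ U) (h0 : φ p = 0) : p ∈ closure Ω := by
  obtain ⟨v, hv⟩ := exists_neg_of_ne_zero (hD.regular p hp)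
  have hlim : Tendsto (fun t : ℝ => p + t • v) (𝓝[>] 0) (𝓝 p) := by
    refine Tendsto.mono_left ?_ nhdsWithin_le_nhds
    have : Continuous fun t : ℝ => p + t • v := by fun_prop
    simpa using this.tendsto 0
  exact mem_closure_of_tendsto hlim (hD.eventually_add_smul_mem hp h0 hv)

lemma mem_frontier_iff (hD : DefiningOn Ω U φ) (hΩ : IsOpen Ω) (hp : p ∈ U) :
    p ∈ frontier Ω ↔ φ p = 0 := by
  rw [hΩ.frontier_eq, Set.mem_sdiff, hD.mem_iff p hp, not_lt]
  constructor
  · rintro ⟨h1, h2⟩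
    refine le_antisymm ?_ h2
    by_contra! hpos
    have hc := (hD.hasFDerivAt hp).continuousAt
    have : ∀ᶠ x in 𝓝 p, x ∉ Ω := by
      filter_upwards [hc.eventually_const_lt hpos, hD.isOpen.mem_nhds hp] with x hx hxU
      rw [hD.mem_iff x hxU]
      exact hx.le.not_gt
    obtain ⟨x, hx, hx'⟩ := (mem_closure_iff_frequently.1 h1).and_eventually this |>.exists
    exact hx' hx
  · intro h0
    exact ⟨hD.mem_closure hp h0, h0.ge⟩

lemma isDefiningAt (hD : DefiningOn Ω U φ) (hp : p ∈ U) (h0 : φ p = 0) : IsDefiningAt Ω p φ :=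
  isDefiningAt_iff.2 ⟨h0, U, hp, hD⟩

end DefiningOn

lemma IsDefiningAt.exists_pos_smul {φ' : Eu n → ℝ} (h : IsDefiningAt Ω p φ)
    (h' : IsDefiningAt Ω p φ') : ∃ c : ℝ, 0 < c ∧ fderiv ℝ φ' p = c • fderiv ℝ φ p := by
  obtain ⟨h0, U, hp, hD⟩ := isDefiningAt_iff.1 h
  obtain ⟨h0', U', hp', hD'⟩ := isDefiningAt_iff.1 h'
  refine exists_pos_smul_eq_of_neg_imp_nonpos (hD.regular p hp) (hD'.regular p hp') fun v hv => ?_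
  by_contra! hpos
  have h1 := hD.eventually_add_smul_mem hp h0 hv
  -- Outside, i.e. in `{φ' > 0}`, points do not belong to `Ω`.
  have h2 : ∀ᶠ t : ℝ in 𝓝[>] 0, 0 < φ' (p + t • v) := by
    have hline : HasDerivAt (fun t : ℝ => p + t • v) v 0 := by
      simpa using ((hasDerivAt_id (0 : ℝ)).smul_const v).const_add p
    have hline0 : p + (0 : ℝ) • v = p := by simp
    have hd : HasDerivAt (fun t : ℝ => φ' (p + t • v)) (fderiv ℝ φ' p v) 0 := by
      have h1 := hD'.hasFDerivAt hp'
      rw [← hline0] at h1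
      simpa using! h1.comp_hasDerivAt (0 : ℝ) hline
    have hslope := (hasDerivAt_iff_tendsto_slope.1 hd).mono_left
      (nhdsWithin_mono (0 : ℝ) (s := Set.Ioi 0) (fun t ht => (ne_of_gt ht : t ≠ 0)))
    filter_upwards [hslope.eventually_const_lt hpos, self_mem_nhdsWithin] with t h2 h3
    have ht : (0 : ℝ) < t := h3
    rwa [slope_def_field, hline0, h0', sub_zero, sub_zero, lt_div_iff₀ ht, zero_mul] at h2
  have h3 : ∀ᶠ t : ℝ in 𝓝[>] 0, p + t • v ∈ U' := by
    have : Continuous fun t : ℝ => p + t • v := by fun_prop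
    refine nhdsWithin_le_nhds (this.continuousAt ?_)
    rw [zero_smul, add_zero]
    exact hD'.isOpen.mem_nhds hp'
  obtain ⟨t, ⟨ha, hb⟩, hc⟩ := ((h1.and h2).and h3).exists
  exact absurd ((hD'.mem_iff _ hc).1 ha) hb.not_gt

lemma IsDefiningAt.unitGrad_eq {φ' : Eu n → ℝ} (h : IsDefiningAt Ω p φ)
    (h' : IsDefiningAt Ω p φ') : unitGrad φ' p = unitGrad φ p := by
  obtain ⟨c, hc, hL⟩ := h.exists_pos_smul h'
  have hg : gradient φ' p = c • gradient φ p := by simp [gradient, hL]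
  rw [unitGrad, unitGrad, hg, norm_smul, Real.norm_of_nonneg hc.le, smul_smul]
  congr 1
  field_simp

lemma IsDefiningAt.mem_bdryTangent_iff (h : IsDefiningAt Ω p φ) (v : Eu n) :
    v ∈ bdryTangent Ω p ↔ inner ℝ (unitGrad φ p) v = 0 := by
  obtain ⟨h0, U, hp, hD⟩ := isDefiningAt_iff.1 h
  rw [hD.inner_unitGrad_eq_zero_iff hp]
  constructor
  · rintro ⟨φ', h', hv⟩
    obtain ⟨c, hc, hL⟩ := h.exists_pos_smul h'
    rw [hL, smul_apply, smul_eq_mul] at hv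
    exact (mul_eq_zero.1 hv).resolve_left hc.ne'
  · exact fun hv => ⟨φ, h, hv⟩

open Classical in
/-- The outward Euclidean unit normal of `∂Ω` (and `0` off the smooth part of the boundary). -/
def outwardNormal (Ω : Set (Eu n)) (p : Eu n) : Eu n :=
  if h : ∃ φ, IsDefiningAt Ω p φ then unitGrad h.choose p else 0

lemma IsDefiningAt.outwardNormal_eq (h : IsDefiningAt Ω p φ) :
    outwardNormal Ω p = unitGrad φ p := by
  have h' : ∃ φ, IsDefiningAt Ω p φ := ⟨φ, h⟩
  rw [outwardNormal, dif_pos h']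
  exact h.unitGrad_eq h'.choose_spec

/-- Local data at a boundary point: a defining function, with `∂Ω` its zero set. -/
lemma exists_definingOn (hM : IsOpen M) (hΩ : IsOpen Ω)
    (hs : ∀ p ∈ bdry M Ω, ∃ φ, IsDefiningAt Ω p φ) (hp : p ∈ bdry M Ω) :
    ∃ φ U, p ∈ U ∧ U ⊆ M ∧ DefiningOn Ω U φ ∧ (∀ x ∈ U, x ∈ bdry M Ω ↔ φ x = 0) ∧
      ∀ x ∈ U, φ x = 0 → outwardNormal Ω x = unitGrad φ x := by
  obtain ⟨φ, hφ⟩ := hs p hp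
  obtain ⟨h0, U, hpU, hD⟩ := isDefiningAt_iff.1 hφ
  have hD' : DefiningOn Ω (U ∩ M) φ := ⟨hD.isOpen.inter hM, hD.smooth.mono Set.inter_subset_left,
    fun x hx => hD.regular x hx.1, fun x hx => hD.mem_iff x hx.1⟩
  refine ⟨φ, U ∩ M, ⟨hpU, hp.2⟩, Set.inter_subset_right, hD', fun x hx => ?_, fun x hx hx0 => ?_⟩
  · rw [bdry, Set.mem_inter_iff, hD'.mem_frontier_iff hΩ hx]
    exact and_iff_left hx.2
  · exact (hD'.isDefiningAt hx hx0).outwardNormal_eq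

lemma continuousOn_outwardNormal (hM : IsOpen M) (hΩ : IsOpen Ω)
    (hs : ∀ p ∈ bdry M Ω, ∃ φ, IsDefiningAt Ω p φ) :
    ContinuousOn (outwardNormal Ω) (bdry M Ω) := by
  intro p hp
  obtain ⟨φ, U, hpU, -, hD, hb, hN⟩ := exists_definingOn hM hΩ hs hp
  have hc : ContinuousWithinAt (unitGrad φ) (bdry M Ω) p :=
    (hD.contDiffOn_unitGrad.continuousOn.continuousAt (hD.isOpen.mem_nhds hpU)).continuousWithinAt
  refine hc.congr_of_eventuallyEq ?_ (hN p hpU ((hb p hpU).1 hp))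
  filter_upwards [nhdsWithin_le_nhds (hD.isOpen.mem_nhds hpU), self_mem_nhdsWithin] with x hx hx'
  exact hN x hx ((hb x hx).1 hx')

lemma norm_outwardNormal (hs : ∀ p ∈ bdry M Ω, ∃ φ, IsDefiningAt Ω p φ) (hp : p ∈ bdry M Ω) :
    ‖outwardNormal Ω p‖ = 1 := by
  obtain ⟨φ, hφ⟩ := hs p hp
  rw [hφ.outwardNormal_eq]
  obtain ⟨h0, U, hpU, hD⟩ := isDefiningAt_iff.1 hφ
  exact norm_unitGrad (hD.regular p hpU)

lemma uniqueDiffWithinAt_union_bdry (hs : ∀ p ∈ bdry M Ω, ∃ φ, IsDefiningAt Ω p φ)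
    (hp : p ∈ bdry M Ω) : UniqueDiffWithinAt ℝ (Ω ∪ bdry M Ω) p := by
  obtain ⟨φ, hφ⟩ := hs p hp
  obtain ⟨h0, U, hpU, hD⟩ := isDefiningAt_iff.1 hφ
  refine UniqueDiffWithinAt.mono ?_ (Set.subset_union_left (s := Ω))
  refine ⟨?_, hD.mem_closure hpU h0⟩
  have hsub : {v | fderiv ℝ φ p v < 0} ⊆ tangentConeAt ℝ Ω p := by
    intro v hv
    refine mem_tangentConeAt_of_add_smul_mem (l := 𝓝[>] (0 : ℝ)) (c := id) ?_
      (hD.eventually_add_smul_mem hpU h0 hv)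
    exact tendsto_id'.2 (nhdsWithin_mono _ fun t ht => ne_of_gt ht)
  have hopen : IsOpen {v | fderiv ℝ φ p v < 0} :=
    isOpen_lt (fderiv ℝ φ p).continuous continuous_const
  have htop : Submodule.span ℝ (tangentConeAt ℝ Ω p) = ⊤ := by
    refine Submodule.eq_top_of_nonempty_interior' _ ?_
    obtain ⟨v, hv⟩ := exists_neg_of_ne_zero (hD.regular p hpU)
    exact ⟨v, mem_interior.2 ⟨_, hsub.trans Submodule.subset_span, hopen, hv⟩⟩
  rw [htop]
  exact dense_univ

end

/-! ### The boundary condition in Euclidean terms -/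

section

open Filter Topology

variable {n : ℕ} {m : ℝ} {M Ω U : Set (Eu n)} {p : Eu n} {φ : Eu n → ℝ}

lemma isOpen_punctured : IsOpen (punctured n) := isOpen_ne

lemma inner_eq_sum (v w : Eu n) : inner ℝ v w = ∑ i, v i * w i := by
  simp [PiLp.inner_apply, mul_comm]

lemma gInner_schwarzschild (x v w : Eu n) :
    gInner (schwarzschild n m) x v w = confL n m ‖x‖ * inner ℝ v w := by
  simp [gInner, schwarzschild_eq, Matrix.one_apply, inner_eq_sum, Finset.mul_sum, mul_assoc]

lemma covDeriv_schwarzschild (hn : 3 ≤ n) (hm : 0 < m) {x : Eu n} (hx : x ≠ 0) (X : Eu n)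
    {Y : Eu n → Eu n} (hY : DifferentiableAt ℝ Y x) :
    covDeriv (schwarzschild n m) x X Y = fderiv ℝ Y x X + confP n m ‖x‖ •
      (inner ℝ x (Y x) • X + inner ℝ x X • Y x - inner ℝ X (Y x) • x) := by
  ext k
  have hG : ∀ k i j, christoffel (schwarzschild n m) k i j x
      = confGamma (fun i => confP n m ‖x‖ * x i) k i j :=
    fun k i j => christoffel_schwarzschild hn hm hx k i j
  have h1 : fderiv ℝ (fun y => Y y k) x X = fderiv ℝ Y x X k := by
    have := (EuclideanSpace.proj k : Eu n →L[ℝ] ℝ).hasFDerivAt.comp x hY.hasFDerivAt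
    have h2 : HasFDerivAt (fun y => Y y k)
      ((EuclideanSpace.proj k : Eu n →L[ℝ] ℝ).comp (fderiv ℝ Y x)) x := this
    rw [h2.fderiv]
    rfl
  have h2 : ∑ i, ∑ j, christoffel (schwarzschild n m) k i j x * X i * Y x j
      = confP n m ‖x‖ * (inner ℝ x (Y x) * X k + inner ℝ x X * Y x k - inner ℝ X (Y x) * x k) := by
    simp only [hG, confGamma, add_mul, sub_mul, ite_mul, zero_mul, Finset.sum_add_distrib,
      Finset.sum_sub_distrib, Finset.sum_ite_eq, Finset.mem_univ, if_true, inner_eq_sum]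
    have e1 : ∑ i, ∑ j, (if k = i then confP n m ‖x‖ * x j * X i * Y x j else 0)
        = confP n m ‖x‖ * ((∑ i, x i * Y x i) * X k) := by
      rw [Finset.sum_comm]
      simp only [Finset.sum_ite_eq, Finset.mem_univ, if_true]
      rw [Finset.sum_mul, Finset.mul_sum]
      exact Finset.sum_congr rfl fun i _ => by ring
    have e2 : ∑ i, confP n m ‖x‖ * x i * X i * Y x k
        = confP n m ‖x‖ * ((∑ i, x i * X i) * Y x k) := by
      rw [Finset.sum_mul, Finset.mul_sum]
      exact Finset.sum_congr rfl fun i _ => by ring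
    have e3 : ∑ i, confP n m ‖x‖ * x k * X i * Y x i
        = confP n m ‖x‖ * ((∑ i, X i * Y x i) * x k) := by
      rw [Finset.sum_mul, Finset.mul_sum]
      exact Finset.sum_congr rfl fun i _ => by ring
    rw [e1, e2, e3]
    ring
  simp only [covDeriv, h1, h2]
  simp

/-- The boundary condition for the multiples of the Schwarzschild potential. It is homogeneous in
`ν`, so that the normalization of `ν` does not matter. -/
lemma boundary_eq_iff (hn : 3 ≤ n) (hm : 0 < m) {T : Set (Eu n)} {u : Eu n → ℝ} {C : ℝ}
    (hu : ∀ x ∈ T, u x = C * potV n m ‖x‖) {x : Eu n} (hx : x ≠ 0) (hxT : x ∈ T)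
    (hT : UniqueDiffWithinAt ℝ T x) {ν X : Eu n} {Y : Eu n → Eu n} (hY : DifferentiableAt ℝ Y x)
    (hX : inner ℝ ν X = 0) (hYν : inner ℝ ν (Y x) = 0) :
    fderivWithin ℝ u T x ν * gInner (schwarzschild n m) x X (Y x)
        = u x * secondFF (schwarzschild n m) x ν X Y ↔
      C * (potV n m ‖x‖ * inner ℝ ν (fderiv ℝ Y x X)
        + (potV' n m ‖x‖ - potV n m ‖x‖ * confP n m ‖x‖) * inner ℝ x ν * inner ℝ X (Y x)) = 0 := by
  have hr := norm_pos_iff.2 hx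
  have hL := (confL_pos (n := n) hm hr).ne'
  have hd : HasFDerivAt (fun y : Eu n => C * potV n m ‖y‖) ((C * potV' n m ‖x‖) • innerSL ℝ x) x :=
    hasFDerivAt_radial (h := fun r => C * potV n m r) hx
      (((hasDerivAt_potV hn hm hr).const_mul C).congr_deriv (by ring))
  have h1 : fderivWithin ℝ u T x = (C * potV' n m ‖x‖) • innerSL ℝ x := by
    rw [fderivWithin_congr hu (hu x hxT)]
    exact hd.hasFDerivWithinAt.fderivWithin hT
  rw [h1, hu x hxT, secondFF, gInner_schwarzschild, gInner_schwarzschild,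
    covDeriv_schwarzschild hn hm hx X hY]
  simp only [smul_apply, innerSL_apply_apply, smul_eq_mul, inner_add_right, inner_sub_right,
    real_inner_smul_right, hX, hYν, real_inner_comm x ν]
  constructor <;> intro h
  · refine (mul_eq_zero_iff_left hL).1 ?_
    linear_combination h
  · linear_combination confL n m ‖x‖ * h

/-! ### The boundary of a non-generic domain is umbilic -/

lemma isOutwardUnitNormal_smul (hm : 0 < m) (hx : p ≠ 0) (h : IsDefiningAt Ω p φ) :
    IsOutwardUnitNormal (schwarzschild n m) Ω p ((√(confL n m ‖p‖))⁻¹ • unitGrad φ p) := by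
  obtain ⟨h0, U, hpU, hD⟩ := isDefiningAt_iff.1 h
  have hL := confL_pos (n := n) hm (norm_pos_iff.2 hx)
  have hs := Real.sqrt_pos.2 hL
  have hN := norm_unitGrad (hD.regular p hpU)
  refine ⟨?_, fun X hX => ?_, φ, h, ?_⟩
  · rw [gInner_schwarzschild, real_inner_smul_left, real_inner_smul_right,
      real_inner_self_eq_norm_sq, hN]
    have := Real.mul_self_sqrt hL.le
    field_simp
    nlinarith
  · rw [gInner_schwarzschild, real_inner_smul_left, (h.mem_bdryTangent_iff X).1 hX]
    simp
  · rw [map_smul, smul_eq_mul]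
    have h1 : ‖gradient φ p‖ ≠ 0 := norm_ne_zero_iff.2 (gradient_ne_zero (hD.regular p hpU))
    have h2 := inner_unitGrad φ p (unitGrad φ p)
    rw [real_inner_self_eq_norm_sq, hN] at h2
    have h3 : fderiv ℝ φ p (unitGrad φ p) = ‖gradient φ p‖ := by
      field_simp at h2
      linarith
    rw [h3]
    positivity

/-- The Weingarten equation of an umbilic boundary. -/
lemma potV_smul_fderiv_unitGrad (hn : 3 ≤ n) (hm : 0 < m) (hM : M ⊆ punctured n)
    (hΩ : IsOpen Ω) (hs : ∀ p ∈ bdry M Ω, ∃ φ, IsDefiningAt Ω p φ)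
    {u : Eu n → ℝ} (hu : IsStaticPotential M (schwarzschild n m) Ω u) {C : ℝ} (hC : C ≠ 0)
    (huC : ∀ x ∈ Ω ∪ bdry M Ω, u x = C * potV n m ‖x‖) (hD : DefiningOn Ω U φ) (hUM : U ⊆ M)
    (hp : p ∈ U) (h0 : φ p = 0) {X : Eu n} (hX : inner ℝ (unitGrad φ p) X = 0) :
    potV n m ‖p‖ • fderiv ℝ (unitGrad φ) p X
      = ((potV' n m ‖p‖ - potV n m ‖p‖ * confP n m ‖p‖) * inner ℝ p (unitGrad φ p)) • X := by
  have hp0 : p ≠ 0 := hM (hUM hp)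
  have hpb : p ∈ bdry M Ω := ⟨(hD.mem_frontier_iff hΩ hp).2 h0, hUM hp⟩
  have hdef := hD.isDefiningAt hp h0
  have hNs := hD.contDiffOn_unitGrad
  have hNd := (differentiableAt_of_contDiffOn hD.isOpen hNs hp).hasFDerivAt
  have hN1 : ∀ x ∈ U, ‖unitGrad φ x‖ = 1 := fun x hx => norm_unitGrad (hD.regular x hx)
  set N := unitGrad φ with hNdef
  set σ := inner ℝ p (N p) with hσ
  set W := potV n m ‖p‖ • fderiv ℝ N p X
    - ((potV' n m ‖p‖ - potV n m ‖p‖ * confP n m ‖p‖) * σ) • X with hW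
  have hNN : inner ℝ (N p) (fderiv ℝ N p X) = 0 := by
    have h1 := (hNd.norm_sq)
    have h2 : (fun x => ‖N x‖ ^ 2) =ᶠ[𝓝 p] fun _ => (1 : ℝ) := by
      filter_upwards [hD.isOpen.mem_nhds hp] with x hx
      rw [hN1 x hx, one_pow]
    have h3 := h1.unique ((hasFDerivAt_const (1 : ℝ) p).congr_of_eventuallyEq h2)
    have := congrArg (fun L : Eu n →L[ℝ] ℝ => L X) h3
    simpa using this
  have hWN : inner ℝ (N p) W = 0 := by
    rw [hW, inner_sub_right, real_inner_smul_right, real_inner_smul_right, hNN, hX]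
    ring
  have key : ∀ Z, inner ℝ (N p) Z = 0 → inner ℝ W Z = 0 := by
    intro Z hZ
    -- The tangential projection of the constant field `Z`.
    set Y : Eu n → Eu n := fun x => Z - inner ℝ (N x) Z • N x with hYdef
    have hYs : ContDiffOn ℝ ∞ Y U :=
      contDiffOn_const.sub ((hNs.inner ℝ contDiffOn_const).smul hNs)
    have hYt : IsTangentFieldAt M Ω p Y := by
      refine ⟨U, hD.isOpen, hp, hYs, fun q hq => ?_⟩
      have hq0 := (hD.mem_frontier_iff hΩ hq.1).1 hq.2.1
      rw [(hD.isDefiningAt hq.1 hq0).mem_bdryTangent_iff, ← hNdef, hYdef]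
      simp only [inner_sub_right, real_inner_smul_right]
      rw [real_inner_self_eq_norm_sq, hN1 q hq.1]
      ring
    have hYp : Y p = Z := by simp [hYdef, hZ]
    have hYd : fderiv ℝ Y p X = -(inner ℝ (fderiv ℝ N p X) Z • N p) := by
      have h1 : HasFDerivAt (fun x => inner ℝ (N x) Z) _ p := hNd.inner ℝ (hasFDerivAt_const Z p)
      have h2 := (hasFDerivAt_const Z p).fun_sub (h1.fun_smul hNd)
      rw [h2.fderiv]
      simp [hZ]
    have hb := hu.boundary_eq p hpb _ (isOutwardUnitNormal_smul hm hp0 hdef) X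
      ((hdef.mem_bdryTangent_iff X).2 hX) Y hYt
    rw [boundary_eq_iff hn hm huC hp0 (Or.inr hpb) (uniqueDiffWithinAt_union_bdry hs hpb)
      (differentiableAt_of_contDiffOn hD.isOpen hYs hp)
      (by rw [real_inner_smul_left, hX, mul_zero])
      (by rw [real_inner_smul_left, hYp, hZ, mul_zero]), hYd, hYp] at hb
    have hb' := (mul_eq_zero.1 hb).resolve_left hC
    simp only [← hNdef, real_inner_smul_left, real_inner_smul_right, inner_neg_right,
      real_inner_self_eq_norm_sq, hN1 p hp, ← hσ] at hb'
    have hsq : (√(confL n m ‖p‖))⁻¹ ≠ 0 :=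
      inv_ne_zero (Real.sqrt_pos.2 (confL_pos hm (norm_pos_iff.2 hp0))).ne'
    rw [hW, inner_sub_left, real_inner_smul_left, real_inner_smul_left]
    refine (mul_eq_zero_iff_left hsq).1 ?_
    linear_combination -hb'
  have := key W hWN
  rw [inner_self_eq_zero] at this
  exact sub_eq_zero.1 this

/-- In dimension at least three there is a nonzero vector orthogonal to two given ones. -/
lemma exists_ne_zero_orthogonal (hn : 3 ≤ n) (a b : Eu n) :
    ∃ v : Eu n, v ≠ 0 ∧ inner ℝ a v = 0 ∧ inner ℝ b v = 0 := by
  classical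
  have h1 : (Submodule.span ℝ (({a, b} : Finset (Eu n)) : Set (Eu n)))ᗮ ≠ ⊥ := by
    intro h
    rw [Submodule.orthogonal_eq_bot_iff] at h
    have h2 := finrank_span_finset_le_card (R := ℝ) ({a, b} : Finset (Eu n))
    rw [Set.finrank, h, finrank_top, finrank_euclideanSpace_fin] at h2
    have := Finset.card_le_two (a := a) (b := b)
    omega
  obtain ⟨v, hv, hv0⟩ := Submodule.exists_mem_ne_zero_of_ne_bot h1
  rw [Submodule.mem_orthogonal] at hv
  exact ⟨v, hv0, hv a (Submodule.subset_span (by simp)), hv b (Submodule.subset_span (by simp))⟩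

/-- The Codazzi equation: the principal curvature of an umbilic hypersurface is locally
constant. -/
lemma fderiv_eq_zero_of_umbilic (hn : 3 ≤ n) (hD : DefiningOn Ω U φ) (hp : p ∈ U) (h0 : φ p = 0)
    {κ : Eu n → ℝ} (hκ : ContDiffAt ℝ 1 κ p)
    (h : ∀ᶠ x in 𝓝 p, φ x = 0 → ∀ X, inner ℝ (unitGrad φ x) X = 0 →
      fderiv ℝ (unitGrad φ) x X = κ x • X) {X : Eu n} (hX : inner ℝ (unitGrad φ p) X = 0) :
    fderiv ℝ κ p X = 0 := by
  have hNs := (hD.contDiffOn_unitGrad).contDiffAt (hD.isOpen.mem_nhds hp)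
  have hNd := (hNs.differentiableAt (by simp)).hasFDerivAt
  have hN1 : ∀ x ∈ U, ‖unitGrad φ x‖ = 1 := fun x hx => norm_unitGrad (hD.regular x hx)
  have htan : ∀ v, inner ℝ (unitGrad φ p) v = 0 → fderiv ℝ φ p v = 0 := fun v =>
    (hD.inner_unitGrad_eq_zero_iff hp v).1
  have hφ : ContDiffAt ℝ 1 φ p :=
    (hD.smooth.contDiffAt (hD.isOpen.mem_nhds hp)).of_le (by exact_mod_cast le_top)
  have hreg := hD.regular p hp
  set N := unitGrad φ with hNdef
  have hN's : ContDiffAt ℝ ∞ (fderiv ℝ N) p := hNs.fderiv_right (by simp)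
  have hN'd := (hN's.differentiableAt (by simp)).hasFDerivAt
  have hsym : IsSymmSndFDerivAt ℝ N p := hNs.isSymmSndFDerivAt
    (by rw [minSmoothness_of_isRCLikeNormedField]; exact WithTop.coe_le_coe.2 le_top)
  have hp' := h.self_of_nhds h0
  -- Differentiate the Weingarten equation of the tangential part of `Z` in direction `Y`.
  have key : ∀ Z Y, inner ℝ (N p) Z = 0 → inner ℝ (N p) Y = 0 →
      fderiv ℝ (fderiv ℝ N) p Y Z - (κ p * inner ℝ Y Z) • fderiv ℝ N p (N p)
        = fderiv ℝ κ p Y • Z - (κ p * κ p * inner ℝ Y Z) • N p := by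
    intro Z Y hZ hY
    set A : Eu n → Eu n := fun x => Z - inner ℝ (N x) Z • N x with hA
    have hAs : ContDiffAt ℝ ∞ A p :=
      contDiffAt_const.sub ((hNs.inner ℝ contDiffAt_const).smul hNs)
    have hAp : A p = Z := by simp [hA, hZ]
    have hAd : fderiv ℝ A p Y = -((κ p * inner ℝ Y Z) • N p) := by
      have h1 : HasFDerivAt (fun x => inner ℝ (N x) Z) _ p := hNd.inner ℝ (hasFDerivAt_const Z p)
      have h2 := (hasFDerivAt_const Z p).fun_sub (h1.fun_smul hNd)
      rw [h2.fderiv]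
      simp [hZ, hp' Y hY, real_inner_smul_left]
    have hA' := (hAs.differentiableAt (by simp)).hasFDerivAt
    set G : Eu n → Eu n := fun x => fderiv ℝ N x (A x) - κ x • A x with hG
    have hle : (1 : WithTop ℕ∞) ≤ ∞ := by exact_mod_cast le_top
    have hGs : ContDiffAt ℝ 1 G p :=
      ((hN's.clm_apply hAs).of_le hle).sub (hκ.smul (hAs.of_le hle))
    have hG0 : ∀ᶠ x in 𝓝 p, φ x = 0 → G x = 0 := by
      filter_upwards [h, hD.isOpen.mem_nhds hp] with x hx hxU hx0
      have : inner ℝ (N x) (A x) = 0 := by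
        simp only [hA, inner_sub_right, real_inner_smul_right]
        rw [real_inner_self_eq_norm_sq, hN1 x hxU]
        ring
      rw [hG]
      simp only [hx hx0 _ this, sub_self]
    have hG' := fderiv_apply_eq_zero_of_eq_zero_on_levelSet hφ hreg h0 hGs hG0 (htan Y hY)
    have hGd := (hN'd.clm_apply hA').fun_sub
      ((hκ.differentiableAt one_ne_zero).hasFDerivAt.fun_smul hA')
    rw [hGd.fderiv] at hG'
    simp only [sub_apply, add_apply, ContinuousLinearMap.comp_apply, ContinuousLinearMap.flip_apply,
      smul_apply, ContinuousLinearMap.smulRight_apply, hAd, hAp, map_neg, map_smul] at hG'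
    rw [← sub_eq_zero, ← hG']
    module
  obtain ⟨Y, hY0, hNY, hXY⟩ := exists_ne_zero_orthogonal hn (N p) X
  have h1 := key X Y hX hNY
  have h2 := key Y X hNY hX
  rw [hsym Y X, real_inner_comm X Y] at h1
  rw [h1] at h2
  have h3 : fderiv ℝ κ p Y • X = fderiv ℝ κ p X • Y := sub_left_injective h2
  have h4 := congrArg (fun v => inner ℝ v Y) h3
  simp only [real_inner_smul_left, hXY, mul_zero] at h4
  exact (mul_eq_zero.1 h4.symm).resolve_right (inner_self_ne_zero.2 hY0)

end

/-! ### Classification of the boundary -/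

section

open Filter Topology

variable {n : ℕ} {m : ℝ} {M Ω U : Set (Eu n)} {p : Eu n} {φ : Eu n → ℝ}

/-- The Weingarten equation `V dN(X) = (V'/r - V f'/r) ⟨x, N⟩ X` along `∂Ω`, in terms of
the unit normals `N` given by local defining functions. -/
def WeingartenEq (n : ℕ) (m : ℝ) (Ω : Set (Eu n)) : Prop :=
  ∀ φ U, DefiningOn Ω U φ → U ⊆ punctured n → ∀ p ∈ U, φ p = 0 →
    ∀ X, inner ℝ (unitGrad φ p) X = 0 →
      potV n m ‖p‖ • fderiv ℝ (unitGrad φ) p X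
        = ((potV' n m ‖p‖ - potV n m ‖p‖ * confP n m ‖p‖) * inner ℝ p (unitGrad φ p)) • X

lemma eventually_norm_eq {h : ℝ → Prop} (hp : ∀ᶠ r in 𝓝 ‖p‖, h r) : ∀ᶠ x in 𝓝 p, h ‖x‖ :=
  continuous_norm.continuousAt.eventually hp

lemma contDiffAt_potV (hm : 0 < m) {r : ℝ} (hr : 0 < r) : ContDiffAt ℝ ∞ (potV n m) r := by
  unfold potV
  exact ContDiffAt.div (by fun_prop) (by fun_prop) (by positivity)

lemma contDiffAt_umbK (hm : 0 < m) {r : ℝ} (hr : 0 < r) (hV : potV n m r ≠ 0) :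
    ContDiffAt ℝ 1 (umbK n m) r := by
  have h := sub_ne_zero.2 ((potV_eq_zero_iff hm hr).not.1 hV)
  unfold umbK
  exact ContDiffAt.div (by fun_prop) (by fun_prop)
    (mul_ne_zero (mul_ne_zero (by positivity) h) (by positivity))

/-- At every boundary point either the position vector is tangent to the boundary, or it is
normal to it. -/
lemma inner_unitGrad_eq_zero_or_eq_smul (hn : 3 ≤ n) (hm : 0 < m) (hW : WeingartenEq n m Ω)
    (hD : DefiningOn Ω U φ) (hU : U ⊆ punctured n) (hp : p ∈ U) (h0 : φ p = 0) :
    inner ℝ p (unitGrad φ p) = 0 ∨ p = inner ℝ p (unitGrad φ p) • unitGrad φ p := by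
  have hp0 : p ≠ 0 := hU hp
  have hr := norm_pos_iff.2 hp0
  have hw := hW φ U hD hU p hp h0
  by_cases hV : potV n m ‖p‖ = 0
  · left
    obtain ⟨X, hX0, hX, -⟩ := exists_ne_zero_orthogonal hn (unitGrad φ p) (unitGrad φ p)
    have h1 := hw X hX
    rw [hV, zero_smul, zero_mul, sub_zero] at h1
    have h2 := (smul_eq_zero.1 h1.symm).resolve_right hX0
    exact (mul_eq_zero.1 h2).resolve_left (potV'_pos hn hm hr).ne'
  by_cases hσ : inner ℝ p (unitGrad φ p) = 0
  · exact Or.inl hσ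
  right
  have hN1 := norm_unitGrad (hD.regular p hp)
  have hNs := (hD.contDiffOn_unitGrad).contDiffAt (hD.isOpen.mem_nhds hp)
  have hNd := (hNs.differentiableAt (by simp)).hasFDerivAt
  set N := unitGrad φ with hNdef
  have hker : ∀ X, inner ℝ (N p) X = 0 → inner ℝ p X = 0 := by
    intro X hX
    have hκs : ContDiffAt ℝ 1 (fun x : Eu n => umbK n m ‖x‖ * inner ℝ x (N x)) p :=
      ((contDiffAt_umbK hm hr hV).comp p (contDiffAt_norm ℝ hp0)).mul
        (contDiffAt_id.inner ℝ (hNs.of_le (by exact_mod_cast le_top)))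
    have hev : ∀ᶠ x in 𝓝 p, φ x = 0 → ∀ X, inner ℝ (N x) X = 0 →
        fderiv ℝ N x X = (umbK n m ‖x‖ * inner ℝ x (N x)) • X := by
      have hVc := eventually_norm_eq ((hasDerivAt_potV hn hm hr).continuousAt.eventually_ne hV)
      filter_upwards [hD.isOpen.mem_nhds hp, hVc] with x hxU hxV hx0 X hX
      have h1 := hW φ U hD hU x hxU hx0 X hX
      rw [← potV_mul_umbK hm (norm_pos_iff.2 (hU hxU)) hxV, mul_assoc, mul_smul] at h1
      exact smul_right_injective _ hxV h1
    have hz := fderiv_eq_zero_of_umbilic hn hD hp h0 hκs hev hX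
    obtain ⟨k', hk, hne⟩ := hasDerivAt_umbK hn hm hr hV
    have hkd := (hasFDerivAt_radial hp0 hk).fun_mul ((hasFDerivAt_id p).inner ℝ hNd)
    have hkd' : HasFDerivAt (fun x : Eu n => umbK n m ‖x‖ * inner ℝ x (N x)) _ p := hkd
    rw [hkd'.fderiv] at hz
    have hdN := hev.self_of_nhds h0 X hX
    have hX' : inner ℝ X (N p) = 0 := by rw [real_inner_comm]; exact hX
    simp [hdN, real_inner_smul_right, hX'] at hz
    have : inner ℝ p X * (inner ℝ p (N p) * (k' + umbK n m ‖p‖ ^ 2)) = 0 := by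
      linear_combination hz
    exact (mul_eq_zero.1 this).resolve_right (mul_ne_zero hσ hne)
  have h1 : inner ℝ (N p) (p - inner ℝ p (N p) • N p) = 0 := by
    rw [inner_sub_right, real_inner_smul_right, real_inner_self_eq_norm_sq, hN1,
      real_inner_comm (N p) p]
    ring
  have h2 : inner ℝ (p - inner ℝ p (N p) • N p) (p - inner ℝ p (N p) • N p) = 0 := by
    conv_lhs => rw [inner_sub_left, real_inner_smul_left, h1, hker _ h1]
    ring
  exact sub_eq_zero.1 (inner_self_eq_zero.1 h2)

lemma IsPreconnected.eq_of_eventuallyEq {α β : Type*} [TopologicalSpace α] {S : Set α}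
    (hS : IsPreconnected S) {f : α → β} (h : ∀ x ∈ S, ∀ᶠ y in 𝓝[S] x, f y = f x) {x y : α}
    (hx : x ∈ S) (hy : y ∈ S) : f x = f y := by
  have := isPreconnected_iff_preconnectedSpace.1 hS
  have hl : IsLocallyConstant (fun z : S => f z) := by
    rw [IsLocallyConstant.iff_eventually_eq]
    intro z
    have := h z z.2
    rwa [← map_nhds_subtype_val, eventually_map] at this
  exact hl.apply_eq_of_preconnectedSpace ⟨x, hx⟩ ⟨y, hy⟩

/-- By connectedness the same alternative holds at all boundary points. -/
lemma forall_inner_eq_zero_or_forall_eq_smul (hn : 3 ≤ n) (hm : 0 < m) (hW : WeingartenEq n m Ω)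
    (hΩ : IsOpen Ω) (hs : ∀ p ∈ bdry (punctured n) Ω, ∃ φ, IsDefiningAt Ω p φ)
    (hc : IsPreconnected (bdry (punctured n) Ω)) :
    (∀ p ∈ bdry (punctured n) Ω, inner ℝ p (outwardNormal Ω p) = 0) ∨
      ∀ p ∈ bdry (punctured n) Ω, p = inner ℝ p (outwardNormal Ω p) • outwardNormal Ω p := by
  set f : Eu n → ℝ := fun p => inner ℝ p (outwardNormal Ω p) ^ 2 / ‖p‖ ^ 2 with hf
  have halt : ∀ p ∈ bdry (punctured n) Ω, inner ℝ p (outwardNormal Ω p) = 0 ∨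
      p = inner ℝ p (outwardNormal Ω p) • outwardNormal Ω p := by
    intro p hp
    obtain ⟨φ, U, hpU, hUM, hD, hb, hN⟩ := exists_definingOn isOpen_punctured hΩ hs hp
    have h0 := (hb p hpU).1 hp
    rw [hN p hpU h0]
    exact inner_unitGrad_eq_zero_or_eq_smul hn hm hW hD hUM hpU h0
  have hr : ∀ p ∈ bdry (punctured n) Ω, ‖p‖ ^ 2 ≠ 0 := fun p hp => by
    have : p ≠ 0 := hp.2
    simpa using this
  -- `⟨x, N⟩ ^ 2 / |x| ^ 2` is continuous with values `0` and `1`.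
  have h1 : ∀ p ∈ bdry (punctured n) Ω,
      p = inner ℝ p (outwardNormal Ω p) • outwardNormal Ω p → f p = 1 := by
    intro p hp h
    have : ‖p‖ ^ 2 = inner ℝ p (outwardNormal Ω p) ^ 2 := by
      conv_lhs => rw [h, norm_smul, norm_outwardNormal hs hp, mul_one, Real.norm_eq_abs, sq_abs]
    rw [hf]
    simp only [← this]
    exact div_self (hr p hp)
  have hmaps : Set.MapsTo f (bdry (punctured n) Ω) ({0, 1} : Set ℝ) := by
    intro p hp
    rcases halt p hp with h | h
    · left; simp [hf, h]
    · right; exact h1 p hp h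
  have hcont : ContinuousOn f (bdry (punctured n) Ω) :=
    ((ContinuousOn.inner (𝕜 := ℝ) continuousOn_id
      (continuousOn_outwardNormal isOpen_punctured hΩ hs)).pow 2).div (by fun_prop) hr
  obtain ⟨y, hy, hconst⟩ := hc.eqOn_const_of_mapsTo (Set.toFinite _).isDiscrete hcont hmaps
    ⟨0, by simp⟩
  rcases hy with rfl | hy
  · left
    intro p hp
    have : f p = 0 := hconst hp
    rw [hf] at this
    exact pow_eq_zero_iff two_ne_zero |>.1 ((div_eq_zero_iff.1 this).resolve_right (hr p hp))
  · right
    intro p hp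
    refine (halt p hp).resolve_left fun h => ?_
    have h2 : f p = y := hconst hp
    rw [hy] at h2
    simp [hf, h] at h2

/-- If the position vector is tangent to the boundary, the unit normal is constant. Where `V = 0`
the Weingarten equation is differentiated in the direction of the position vector. -/
lemma fderiv_unitGrad_eq_zero (hn : 3 ≤ n) (hm : 0 < m) (hW : WeingartenEq n m Ω)
    (hD : DefiningOn Ω U φ) (hU : U ⊆ punctured n)
    (hσ : ∀ x ∈ U, φ x = 0 → inner ℝ x (unitGrad φ x) = 0) (hp : p ∈ U) (h0 : φ p = 0)
    {X : Eu n} (hX : inner ℝ (unitGrad φ p) X = 0) : fderiv ℝ (unitGrad φ) p X = 0 := by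
  have hp0 : p ≠ 0 := hU hp
  have hr := norm_pos_iff.2 hp0
  have hz : ∀ x ∈ U, φ x = 0 → ∀ X, inner ℝ (unitGrad φ x) X = 0 →
      potV n m ‖x‖ • fderiv ℝ (unitGrad φ) x X = 0 := by
    intro x hx hx0 X hX
    rw [hW φ U hD hU x hx hx0 X hX, hσ x hx hx0, mul_zero, zero_smul]
  by_cases hV : potV n m ‖p‖ = 0
  swap
  · exact (smul_eq_zero.1 (hz p hp h0 X hX)).resolve_left hV
  have hNs := (hD.contDiffOn_unitGrad).contDiffAt (hD.isOpen.mem_nhds hp)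
  have hN1 : ∀ x ∈ U, ‖unitGrad φ x‖ = 1 := fun x hx => norm_unitGrad (hD.regular x hx)
  have hφ : ContDiffAt ℝ 1 φ p :=
    (hD.smooth.contDiffAt (hD.isOpen.mem_nhds hp)).of_le (by exact_mod_cast le_top)
  have hreg := hD.regular p hp
  have hptan : fderiv ℝ φ p p = 0 := by
    rw [← hD.inner_unitGrad_eq_zero_iff hp, real_inner_comm]
    exact hσ p hp h0
  set N := unitGrad φ with hNdef
  set A : Eu n → Eu n := fun x => fderiv ℝ N x (X - inner ℝ (N x) X • N x) with hA
  have hAs : ContDiffAt ℝ ∞ A p := by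
    have hN's : ContDiffAt ℝ ∞ (fderiv ℝ N) p := hNs.fderiv_right (by simp)
    exact hN's.clm_apply (contDiffAt_const.sub ((hNs.inner ℝ contDiffAt_const).smul hNs))
  have hVs : ContDiffAt ℝ ∞ (fun x : Eu n => potV n m ‖x‖) p :=
    (contDiffAt_potV hm hr).comp p (contDiffAt_norm ℝ hp0)
  have hG0 : ∀ᶠ x in 𝓝 p, φ x = 0 → potV n m ‖x‖ • A x = 0 := by
    filter_upwards [hD.isOpen.mem_nhds hp] with x hx hx0
    refine hz x hx hx0 _ ?_
    simp only [inner_sub_right, real_inner_smul_right]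
    rw [real_inner_self_eq_norm_sq, hN1 x hx]
    ring
  have h1 : fderiv ℝ (fun x : Eu n => potV n m ‖x‖ • A x) p p = 0 :=
    fderiv_apply_eq_zero_of_eq_zero_on_levelSet hφ hreg h0 ((hVs.smul hAs).of_le (by exact_mod_cast le_top)) hG0 hptan
  have h2 := (hasFDerivAt_radial hp0 (hasDerivAt_potV hn hm hr)).fun_smul
    (hAs.differentiableAt (by simp)).hasFDerivAt
  have h3 : HasFDerivAt (fun x : Eu n => potV n m ‖x‖ • A x) _ p := h2
  rw [h3.fderiv] at h1
  simp only [smul_apply, hV, zero_smul, zero_add, ContinuousLinearMap.smulRight_apply,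
    innerSL_apply_apply, real_inner_self_eq_norm_sq, smul_eq_mul] at h1
  have h4 := (smul_eq_zero.1 h1).resolve_left
    (mul_ne_zero (potV'_pos hn hm hr).ne' (pow_ne_zero 2 hr.ne'))
  simpa [hA, hX] using h4

lemma exists_bdry_subset_hyperplane (hn : 3 ≤ n) (hm : 0 < m) (hW : WeingartenEq n m Ω)
    (hΩ : IsOpen Ω) (hs : ∀ p ∈ bdry (punctured n) Ω, ∃ φ, IsDefiningAt Ω p φ)
    (hc : IsConnected (bdry (punctured n) Ω))
    (hσ : ∀ p ∈ bdry (punctured n) Ω, inner ℝ p (outwardNormal Ω p) = 0) :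
    ∃ a : Eu n, a ≠ 0 ∧ bdry (punctured n) Ω ⊆ {x | inner ℝ a x = 0} := by
  have hloc : ∀ p ∈ bdry (punctured n) Ω, ∀ᶠ x in 𝓝[bdry (punctured n) Ω] p,
      outwardNormal Ω x = outwardNormal Ω p := by
    intro p hp
    obtain ⟨φ, U, hpU, hUM, hD, hb, hN⟩ := exists_definingOn isOpen_punctured hΩ hs hp
    have h0 := (hb p hpU).1 hp
    have hσ' : ∀ x ∈ U, φ x = 0 → inner ℝ x (unitGrad φ x) = 0 := by
      intro x hx hx0
      rw [← hN x hx hx0]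
      exact hσ x ((hb x hx).2 hx0)
    have hev := eventually_eq_of_fderiv_eq_zero_on_levelSet hD.isOpen hpU hD.smooth
      (hD.regular p hpU) h0
      (fun x hx => differentiableAt_of_contDiffOn hD.isOpen hD.contDiffOn_unitGrad hx)
      (fun x hx hx0 v hv => fderiv_unitGrad_eq_zero hn hm hW hD hUM hσ' hx hx0
        ((hD.inner_unitGrad_eq_zero_iff hx v).2 hv))
    filter_upwards [nhdsWithin_le_nhds hev, nhdsWithin_le_nhds (hD.isOpen.mem_nhds hpU),
      self_mem_nhdsWithin] with x hx hxU hxb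
    have hx0 := (hb x hxU).1 hxb
    rw [hN x hxU hx0, hN p hpU h0, hx hx0]
  obtain ⟨p, hp⟩ := hc.nonempty
  refine ⟨outwardNormal Ω p, fun h => ?_, fun x hx => ?_⟩
  · have := norm_outwardNormal hs hp
    rw [h, norm_zero] at this
    exact zero_ne_one this
  · have := hσ x hx
    rw [IsPreconnected.eq_of_eventuallyEq hc.isPreconnected hloc hx hp, real_inner_comm] at this
    exact this

/-- If the position vector is normal to the boundary, the boundary lies in a sphere around `0`, and
the Weingarten equation determines the radius. -/
lemma exists_bdry_subset_sphere (hn : 3 ≤ n) (hm : 0 < m) (hW : WeingartenEq n m Ω)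
    (hΩ : IsOpen Ω) (hs : ∀ p ∈ bdry (punctured n) Ω, ∃ φ, IsDefiningAt Ω p φ)
    (hc : IsConnected (bdry (punctured n) Ω))
    (hσ : ∀ p ∈ bdry (punctured n) Ω, p = inner ℝ p (outwardNormal Ω p) • outwardNormal Ω p) :
    ∃ r > 0, bdry (punctured n) Ω ⊆ Metric.sphere (0 : Eu n) r ∧
      potV n m r ^ 2 = potV' n m r * r ^ 2 := by
  have hloc : ∀ p ∈ bdry (punctured n) Ω, ∀ᶠ x in 𝓝[bdry (punctured n) Ω] p,
      ‖x‖ ^ 2 = ‖p‖ ^ 2 := by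
    intro p hp
    obtain ⟨φ, U, hpU, hUM, hD, hb, hN⟩ := exists_definingOn isOpen_punctured hΩ hs hp
    have h0 := (hb p hpU).1 hp
    have hev := eventually_eq_of_fderiv_eq_zero_on_levelSet (G := fun x : Eu n => ‖x‖ ^ 2)
      hD.isOpen hpU hD.smooth (hD.regular p hpU) h0
      (fun x _ => (hasStrictFDerivAt_norm_sq x).hasFDerivAt.differentiableAt)
      (fun x hx hx0 v hv => by
        rw [(hasStrictFDerivAt_norm_sq x).hasFDerivAt.fderiv]
        have h1 := (hD.inner_unitGrad_eq_zero_iff hx v).2 hv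
        rw [← hN x hx hx0] at h1
        have h2 : inner ℝ x v = 0 := by
          rw [hσ x ((hb x hx).2 hx0), real_inner_smul_left, h1, mul_zero]
        simp [h2])
    filter_upwards [nhdsWithin_le_nhds hev, nhdsWithin_le_nhds (hD.isOpen.mem_nhds hpU),
      self_mem_nhdsWithin] with x hx hxU hxb
    exact hx ((hb x hxU).1 hxb)
  obtain ⟨p, hp⟩ := hc.nonempty
  have hp0 : p ≠ 0 := hp.2
  have hr := norm_pos_iff.2 hp0
  refine ⟨‖p‖, hr, fun x hx => ?_, ?_⟩
  · rw [mem_sphere_zero_iff_norm]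
    exact (sq_eq_sq₀ (norm_nonneg _) (norm_nonneg _)).1
      (IsPreconnected.eq_of_eventuallyEq hc.isPreconnected hloc hx hp)
  obtain ⟨φ, U, hpU, hUM, hD, hb, hN⟩ := exists_definingOn isOpen_punctured hΩ hs hp
  have h0 := (hb p hpU).1 hp
  have hNs := (hD.contDiffOn_unitGrad).contDiffAt (hD.isOpen.mem_nhds hpU)
  have hNd := (hNs.differentiableAt (by simp)).hasFDerivAt
  have hN1 := norm_unitGrad (hD.regular p hpU)
  have hφ : ContDiffAt ℝ 1 φ p :=
    (hD.smooth.contDiffAt (hD.isOpen.mem_nhds hpU)).of_le (by exact_mod_cast le_top)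
  obtain ⟨X, hX0, hX, -⟩ := exists_ne_zero_orthogonal hn (unitGrad φ p) (unitGrad φ p)
  have hw := hW φ U hD hUM p hpU h0 X hX
  have hreg := hD.regular p hpU
  have hXφ := (hD.inner_unitGrad_eq_zero_iff hpU X).1 hX
  have hG0 : ∀ᶠ x in 𝓝 p, φ x = 0 → x - inner ℝ x (unitGrad φ x) • unitGrad φ x = 0 := by
    filter_upwards [hD.isOpen.mem_nhds hpU] with x hx hx0
    rw [← hN x hx hx0]
    exact sub_eq_zero.2 (hσ x ((hb x hx).2 hx0))
  have hpN : p = inner ℝ p (unitGrad φ p) • unitGrad φ p := sub_eq_zero.1 (hG0.self_of_nhds h0)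
  set N := unitGrad φ with hNdef
  set σ := inner ℝ p (N p) with hσdef
  have hσ2 : σ ^ 2 = ‖p‖ ^ 2 := by
    conv_rhs => rw [hpN, norm_smul, hN1, mul_one, Real.norm_eq_abs, sq_abs]
  -- Differentiate `x = ⟨x, N⟩ N`.
  have hGs : ContDiffAt ℝ 1 (fun x => x - inner ℝ x (N x) • N x) p :=
    (contDiffAt_id.sub ((contDiffAt_id.inner ℝ hNs).smul hNs)).of_le (by exact_mod_cast le_top)
  have h1 := fderiv_apply_eq_zero_of_eq_zero_on_levelSet hφ hreg h0 hGs hG0 hXφ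
  have h2 : HasFDerivAt (fun x => x - inner ℝ x (N x) • N x) _ p :=
    (hasFDerivAt_id p).fun_sub (((hasFDerivAt_id p).inner ℝ hNd).fun_smul hNd)
  rw [h2.fderiv] at h1
  have h3 := congrArg (fun v => inner ℝ v X) h1
  simp only [sub_apply, add_apply, smul_apply, ContinuousLinearMap.smulRight_apply, inner_sub_left,
    inner_add_left, real_inner_smul_left, hX, id, ContinuousLinearMap.id_apply, ← hσdef,
    inner_zero_left, mul_zero, add_zero] at h3
  have h4 := congrArg (fun v => inner ℝ v X) hw
  simp only [real_inner_smul_left] at h4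
  have hXX : inner ℝ X X ≠ 0 := inner_self_ne_zero.2 hX0
  have h5 : potV n m ‖p‖
      = (potV' n m ‖p‖ - potV n m ‖p‖ * confP n m ‖p‖) * ‖p‖ ^ 2 := by
    refine mul_right_cancel₀ hXX ?_
    rw [← hσ2]
    linear_combination potV n m ‖p‖ * h3 + σ * h4
  linear_combination h5 - potV n m ‖p‖ * one_add_confP_mul (n := n) hm hr

end

/-! ### Boundaries inside spheres and hyperplanes -/

section

open Filter Topology

variable {n : ℕ} {m : ℝ} {M Ω U : Set (Eu n)} {p : Eu n} {φ : Eu n → ℝ}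

/-- The equation of the critical radii, a quadratic equation for `r^(n-2)`. -/
lemma potV_sq_eq_iff (hn : 3 ≤ n) (hm : 0 < m) {r : ℝ} (hr : 0 < r) :
    potV n m r ^ 2 = potV' n m r * r ^ 2 ↔ r = radiusPlus n m ∨ r = radiusMinus n m := by
  have h3 : (3 : ℝ) ≤ n := by exact_mod_cast hn
  have hD0 : (0 : ℝ) ≤ (n : ℝ) ^ 2 - 2 * n := by nlinarith
  set D := √((n : ℝ) ^ 2 - 2 * n) with hD
  have hDsq : D ^ 2 = (n : ℝ) ^ 2 - 2 * n := Real.sq_sqrt hD0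
  have hDpos : 0 ≤ D := Real.sqrt_nonneg _
  have hDlt : D < (n : ℝ) - 1 := by nlinarith
  have hcast : (n : ℝ) - 2 = ((n - 2 : ℕ) : ℝ) := by
    rw [Nat.cast_sub (by omega)]; norm_num
  have hroot : ∀ t : ℝ, 0 < t → (r ^ (n - 2) = t ↔ r = t ^ (1 / ((n : ℝ) - 2))) := by
    intro t ht
    rw [hcast, one_div]
    constructor
    · rintro rfl
      exact (Real.pow_rpow_inv_natCast hr.le (by omega)).symm
    · rintro rfl
      exact Real.rpow_inv_natCast_pow ht.le (by omega)
  rw [radiusPlus, radiusMinus, ← hD, ← hroot _ (by nlinarith), ← hroot _ (by nlinarith)]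
  have hp : 0 < r ^ (n - 2) := by positivity
  unfold potV potV'
  generalize r ^ (n - 2) = t at *
  have h1 : t + m / 2 ≠ 0 := by positivity
  have h1' : 2 * t + m ≠ 0 := by positivity
  have hr0 := hr.ne'
  have : ((t - m / 2) / (t + m / 2)) ^ 2 - m * (n - 2) * t / (r ^ 2 * (t + m / 2) ^ 2) * r ^ 2
      = (t - (n - 1 + D) / 2 * m) * (t - (n - 1 - D) / 2 * m) / (t + m / 2) ^ 2 := by
    field_simp
    linear_combination m ^ 2 * hDsq
  rw [← sub_eq_zero, this, div_eq_zero_iff, or_iff_left (pow_ne_zero 2 h1), mul_eq_zero, sub_eq_zero,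
    sub_eq_zero]

/-- A boundary contained in a hypersurface `S` that separates `M` into the two connected sides `A`
and `B` is all of `S`. -/
lemma bdry_eq_of_subset {A B S : Set (Eu n)} (hΩ : IsOpen Ω) (hΩne : Ω.Nonempty) (hΩM : Ω ⊆ M)
    (hM : IsOpen M) (hs : ∀ p ∈ bdry M Ω, ∃ φ, IsDefiningAt Ω p φ) (hne : (bdry M Ω).Nonempty)
    (hsub : bdry M Ω ⊆ S) (hSM : S ⊆ M) (hcover : M ⊆ A ∪ B ∪ S)
    (hA : IsPreconnected A) (hB : IsPreconnected B)
    (hAM : A ⊆ M \ S) (hBM : B ⊆ M \ S) (hSA : S ⊆ closure A) (hSB : S ⊆ closure B) :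
    bdry M Ω = S := by
  have side : ∀ W : Set (Eu n), IsPreconnected W → W ⊆ M \ S → W ⊆ Ω ∨ Disjoint W Ω := by
    intro W hW hWM
    by_contra! hcon
    obtain ⟨x, hxW, hxΩ⟩ := Set.not_subset.1 hcon.1
    obtain ⟨y, hyW, hyΩ⟩ := Set.not_disjoint_iff.1 hcon.2
    have hcl : ∀ z ∈ W, z ∉ Ω → z ∈ (closure Ω)ᶜ := by
      intro z hzW hzΩ hz
      exact (hWM hzW).2 (hsub ⟨by rw [hΩ.frontier_eq]; exact ⟨hz, hzΩ⟩, (hWM hzW).1⟩)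
    obtain ⟨z, -, hz, hz'⟩ := hW Ω (closure Ω)ᶜ hΩ isClosed_closure.isOpen_compl
      (fun z hzW => or_iff_not_imp_left.2 (hcl z hzW)) ⟨y, hyW, hyΩ⟩ ⟨x, hxW, hcl x hxW hxΩ⟩
    exact hz' (subset_closure hz)
  have half : ∀ A B : Set (Eu n), S ⊆ closure A → S ⊆ closure B → A ⊆ Ω → Disjoint B Ω →
      S ⊆ bdry M Ω := by
    intro A B hSA hSB hAΩ hBΩ x hx
    refine ⟨?_, hSM hx⟩
    rw [hΩ.frontier_eq]
    refine ⟨closure_mono hAΩ (hSA hx), fun hxΩ => ?_⟩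
    obtain ⟨y, hyΩ, hyB⟩ := mem_closure_iff.1 (hSB hx) Ω hΩ hxΩ
    exact Set.disjoint_left.1 hBΩ hyB hyΩ
  refine hsub.antisymm ?_
  rcases side A hA hAM with hAΩ | hAΩ <;> rcases side B hB hBM with hBΩ | hBΩ
  · -- The outside of `Ω` near a boundary point would lie in `S`, which has no interior.
    exfalso
    obtain ⟨p, hp⟩ := hne
    obtain ⟨φ, U, hpU, hUM, hD, hb, -⟩ := exists_definingOn hM hΩ hs hp
    have h0 := (hb p hpU).1 hp
    have hnot : ¬ IsLocalMax φ p := fun h => hD.regular p hpU h.fderiv_eq_zero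
    have hfr : ∃ᶠ x in 𝓝 p, φ p < φ x := by
      intro h
      exact hnot (h.mono fun x hx => not_lt.1 hx)
    obtain ⟨x, hxφ, hxU⟩ := (hfr.and_eventually (hD.isOpen.mem_nhds hpU)).exists
    rw [h0] at hxφ
    have hxΩ : x ∉ Ω := fun h => hxφ.not_gt ((hD.mem_iff x hxU).1 h)
    have hxS : x ∈ S := by
      rcases hcover (hUM hxU) with (h | h) | h
      · exact absurd (hAΩ h) hxΩ
      · exact absurd (hBΩ h) hxΩ
      · exact h
    have hev : ∀ᶠ y in 𝓝 x, 0 < φ y ∧ y ∈ U :=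
      ((hD.hasFDerivAt hxU).continuousAt.eventually_const_lt hxφ).and (hD.isOpen.mem_nhds hxU)
    obtain ⟨y, hyA, hy, hyU⟩ := (mem_closure_iff_frequently.1 (hSA hxS)).and_eventually hev |>.exists
    exact hy.not_gt ((hD.mem_iff y hyU).1 (hAΩ hyA))
  · exact half A B hSA hSB hAΩ hBΩ
  · exact half B A hSB hSA hBΩ hAΩ
  · exfalso
    obtain ⟨x, hx⟩ := hΩne
    rcases hcover (hΩM hx) with (h | h) | h
    · exact Set.disjoint_left.1 hAΩ h hx
    · exact Set.disjoint_left.1 hBΩ h hx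
    · obtain ⟨y, hyΩ, hyA⟩ := mem_closure_iff.1 (hSA h) Ω hΩ hx
      exact Set.disjoint_left.1 hAΩ hyA hyΩ

lemma one_lt_rank (hn : 3 ≤ n) : 1 < Module.rank ℝ (Eu n) := by
  rw [← Module.finrank_eq_rank, finrank_euclideanSpace_fin]
  exact_mod_cast (by omega : 1 < n)

lemma isPreconnected_norm_preimage (hn : 3 ≤ n) {I : Set ℝ} (hI : IsPreconnected I)
    (h0 : I ⊆ Set.Ioi 0) : IsPreconnected {x : Eu n | ‖x‖ ∈ I} := by
  have hS : IsPreconnected (Metric.sphere (0 : Eu n) 1) :=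
    (isConnected_sphere (one_lt_rank hn) 0 zero_le_one).isPreconnected
  have him := (hI.prod hS).image (fun q : ℝ × Eu n => q.1 • q.2) (by fun_prop)
  convert him using 1
  ext x
  simp only [Set.mem_ofPred_eq, Set.mem_image, Set.mem_prod, mem_sphere_zero_iff_norm, Prod.exists]
  constructor
  · intro hx
    have : ‖x‖ ≠ 0 := (h0 hx).ne'
    exact ⟨‖x‖, ‖x‖⁻¹ • x, ⟨hx, by rw [norm_smul, norm_inv, norm_norm, inv_mul_cancel₀ this]⟩,
      by rw [smul_smul, mul_inv_cancel₀ this, one_smul]⟩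
  · rintro ⟨s, y, ⟨hs, hy⟩, rfl⟩
    rwa [norm_smul, hy, mul_one, Real.norm_of_nonneg (h0 hs).le]

/-- A point is in the closure of a set that contains the initial part of a ray starting at it. -/
lemma mem_closure_of_ray {S : Set (Eu n)} {x v : Eu n} (h : ∀ᶠ t : ℝ in 𝓝[>] 0, x + t • v ∈ S) :
    x ∈ closure S := by
  have hlim : Tendsto (fun t : ℝ => x + t • v) (𝓝[>] 0) (𝓝 x) := by
    refine Tendsto.mono_left ?_ nhdsWithin_le_nhds
    have : Continuous fun t : ℝ => x + t • v := by fun_prop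
    simpa using this.tendsto 0
  exact mem_closure_of_tendsto hlim h

lemma bdry_eq_sphere (hn : 3 ≤ n) {r : ℝ} (hr : 0 < r) (hΩ : IsOpen Ω) (hΩne : Ω.Nonempty)
    (hΩM : Ω ⊆ punctured n) (hs : ∀ p ∈ bdry (punctured n) Ω, ∃ φ, IsDefiningAt Ω p φ)
    (hne : (bdry (punctured n) Ω).Nonempty)
    (hsub : bdry (punctured n) Ω ⊆ Metric.sphere (0 : Eu n) r) :
    bdry (punctured n) Ω = Metric.sphere (0 : Eu n) r := by
  have hpos : ∀ x : Eu n, x ∈ punctured n ↔ 0 < ‖x‖ := fun x => norm_pos_iff.symm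
  refine bdry_eq_of_subset (A := {x | ‖x‖ ∈ Set.Ioo 0 r}) (B := {x | ‖x‖ ∈ Set.Ioi r}) hΩ hΩne hΩM
    isOpen_punctured hs hne hsub ?_ ?_ (isPreconnected_norm_preimage hn isPreconnected_Ioo ?_)
    (isPreconnected_norm_preimage hn isPreconnected_Ioi ?_) ?_ ?_ ?_ ?_
  · intro x hx
    rw [hpos, mem_sphere_zero_iff_norm.1 hx]
    exact hr
  · intro x hx
    rw [hpos] at hx
    rcases lt_trichotomy ‖x‖ r with h | h | h
    · exact Or.inl (Or.inl ⟨hx, h⟩)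
    · exact Or.inr (mem_sphere_zero_iff_norm.2 h)
    · exact Or.inl (Or.inr h)
  · exact fun s hs => hs.1
  · exact fun s hs => hr.trans hs
  · intro x hx
    exact ⟨(hpos x).2 hx.1, fun h => hx.2.ne (mem_sphere_zero_iff_norm.1 h)⟩
  · intro x hx
    exact ⟨(hpos x).2 (hr.trans hx), fun h => hx.ne' (mem_sphere_zero_iff_norm.1 h)⟩
  · intro x hx
    refine mem_closure_of_ray (v := -x) ?_
    filter_upwards [Ioo_mem_nhdsGT (zero_lt_one' ℝ)] with t ht
    have h1 : x + t • -x = (1 - t) • x := by module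
    rw [h1, norm_smul, mem_sphere_zero_iff_norm.1 hx,
      Real.norm_of_nonneg (by linarith [ht.2])]
    have := ht.1
    have := ht.2
    constructor <;> nlinarith
  · intro x hx
    refine mem_closure_of_ray (v := x) ?_
    filter_upwards [self_mem_nhdsWithin] with t ht
    have h1 : x + t • x = (1 + t) • x := by module
    have ht' : (0 : ℝ) < t := ht
    rw [h1, norm_smul, mem_sphere_zero_iff_norm.1 hx,
      Real.norm_of_nonneg (by linarith)]
    change r < _
    nlinarith

lemma bdry_eq_hyperplane {a : Eu n} (ha : a ≠ 0) (hΩ : IsOpen Ω) (hΩne : Ω.Nonempty)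
    (hΩM : Ω ⊆ punctured n) (hs : ∀ p ∈ bdry (punctured n) Ω, ∃ φ, IsDefiningAt Ω p φ)
    (hne : (bdry (punctured n) Ω).Nonempty)
    (hsub : bdry (punctured n) Ω ⊆ {x | inner ℝ a x = 0}) :
    bdry (punctured n) Ω = {x | inner ℝ a x = 0} ∩ punctured n := by
  have haa : 0 < inner ℝ a a := real_inner_self_pos.2 ha
  have hnz : ∀ x : Eu n, inner ℝ a x ≠ 0 → x ∈ punctured n := by
    rintro x hx rfl
    exact hx (inner_zero_right a)
  refine bdry_eq_of_subset (A := {x | inner ℝ a x < 0}) (B := {x | 0 < inner ℝ a x}) hΩ hΩne hΩM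
    isOpen_punctured hs hne (fun x hx => ⟨hsub hx, hx.2⟩) (fun x hx => hx.2) ?_ ?_ ?_ ?_ ?_ ?_ ?_
  · intro x hx
    rcases lt_trichotomy (inner ℝ a x) 0 with h | h | h
    · exact Or.inl (Or.inl h)
    · exact Or.inr ⟨h, hx⟩
    · exact Or.inl (Or.inr h)
  · exact (convex_halfSpace_lt (f := fun x => inner ℝ a x)
      (innerSL ℝ a).toLinearMap.isLinear 0).isPreconnected
  · exact (convex_halfSpace_gt (f := fun x => inner ℝ a x)
      (innerSL ℝ a).toLinearMap.isLinear 0).isPreconnected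
  · exact fun x hx => ⟨hnz x (ne_of_lt hx), fun h => (ne_of_lt hx) h.1⟩
  · exact fun x hx => ⟨hnz x (ne_of_gt hx), fun h => (ne_of_gt hx) h.1⟩
  · intro x hx
    refine mem_closure_of_ray (v := -a) ?_
    filter_upwards [self_mem_nhdsWithin] with t ht
    have h1 : inner ℝ a x = 0 := hx.1
    have ht' : (0 : ℝ) < t := ht
    rw [inner_add_right, h1, real_inner_smul_right, inner_neg_right]
    nlinarith
  · intro x hx
    refine mem_closure_of_ray (v := a) ?_
    filter_upwards [self_mem_nhdsWithin] with t ht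
    have h1 : inner ℝ a x = 0 := hx.1
    have ht' : (0 : ℝ) < t := ht
    rw [inner_add_right, h1, real_inner_smul_right]
    nlinarith

end

/-! ### Non-generic domains -/

section

open Filter Topology

variable {n : ℕ} {m : ℝ} {M Ω U : Set (Eu n)} {p : Eu n} {φ : Eu n → ℝ}

/-- A static potential is a nonzero multiple of `potV`, up to the boundary. -/
lemma IsStaticPotential.exists_eq_const_mul_potV (hn : 3 ≤ n) (hm : 0 < m)
    (hΩ : IsSmoothDomain (punctured n) (schwarzschild n m) Ω) {u : Eu n → ℝ}
    (hu : IsStaticPotential (punctured n) (schwarzschild n m) Ω u) :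
    ∃ C ≠ 0, ∀ x ∈ Ω ∪ bdry (punctured n) Ω, u x = C * potV n m ‖x‖ := by
  obtain ⟨C, hC⟩ := StaticBdry.exists_eq_const_mul_potV hn hm hΩ.isOpen hΩ.subset
    hΩ.isConnected.isPreconnected (hu.smooth.mono Set.subset_union_left) hu.interior_eq
  have hall : ∀ x ∈ Ω ∪ bdry (punctured n) Ω, u x = C * potV n m ‖x‖ := by
    rintro x (hx | hx)
    · exact hC x hx
    have hx0 : x ≠ 0 := hx.2
    have hcl : x ∈ closure Ω := frontier_subset_closure hx.1
    have : (𝓝[Ω] x).NeBot := mem_closure_iff_nhdsWithin_neBot.1 hcl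
    have h1 : Tendsto u (𝓝[Ω] x) (𝓝 (u x)) :=
      ((hu.smooth.continuousOn x (Or.inr hx)).mono Set.subset_union_left).tendsto
    have h2 : Tendsto (fun y : Eu n => C * potV n m ‖y‖) (𝓝[Ω] x) (𝓝 (C * potV n m ‖x‖)) :=
      ((hasFDerivAt_radial hx0 (hasDerivAt_potV hn hm
        (norm_pos_iff.2 hx0))).continuousAt.tendsto.const_mul C).mono_left nhdsWithin_le_nhds
    refine tendsto_nhds_unique (h1.congr' ?_) h2
    filter_upwards [self_mem_nhdsWithin] with y hy using hC y hy
  refine ⟨C, ?_, hall⟩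
  rintro rfl
  obtain ⟨x, hx, hx0⟩ := hu.nontrivial
  exact hx0 (by rw [hall x hx, zero_mul])

lemma IsCriticalSphere.of_radius {r : ℝ} {S : Set (Eu n)} (hn : 3 ≤ n) (hm : 0 < m) (hr : 0 < r)
    (h : potV n m r ^ 2 = potV' n m r * r ^ 2) (hS : S = Metric.sphere 0 r) :
    IsCriticalSphere m S := by
  rcases (potV_sq_eq_iff hn hm hr).1 h with rfl | rfl
  · exact Or.inl hS
  · exact Or.inr hS

/-- The boundary of a non-generic domain with connected boundary is one of the listed
hypersurfaces. -/
lemma bdry_of_isNonGeneric (hn : 3 ≤ n) (hm : 0 < m)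
    (hc : IsConnected (bdry (punctured n) Ω))
    (h : IsNonGeneric (punctured n) (schwarzschild n m) Ω) :
    IsCriticalSphere m (bdry (punctured n) Ω) ∨
      IsCentralHyperplane (bdry (punctured n) Ω) := by
  obtain ⟨hΩ, u, hu⟩ := h
  obtain ⟨C, hC, huC⟩ := hu.exists_eq_const_mul_potV hn hm hΩ
  have hs := hΩ.smooth_bdry
  have hW : WeingartenEq n m Ω := fun φ U hD hU p hp h0 X hX =>
    potV_smul_fderiv_unitGrad hn hm subset_rfl hΩ.isOpen hs hu hC huC hD hU hp h0 hX
  rcases forall_inner_eq_zero_or_forall_eq_smul hn hm hW hΩ.isOpen hs hc.isPreconnected with hσ | hσ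
  · right
    obtain ⟨a, ha, hsub⟩ := exists_bdry_subset_hyperplane hn hm hW hΩ.isOpen hs hc hσ
    exact ⟨a, ha, bdry_eq_hyperplane ha hΩ.isOpen hΩ.isConnected.nonempty hΩ.subset hs hc.nonempty
      hsub⟩
  · left
    obtain ⟨r, hr, hsub, heq⟩ := exists_bdry_subset_sphere hn hm hW hΩ.isOpen hs hc hσ
    exact IsCriticalSphere.of_radius hn hm hr heq (bdry_eq_sphere hn hr hΩ.isOpen
      hΩ.isConnected.nonempty hΩ.subset hs hc.nonempty hsub)

/-! ### Spheres and hyperplanes as boundaries of non-generic domains -/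

/-- A smooth function that vanishes on the boundary has vanishing tangential derivative. -/
lemma fderiv_apply_eq_zero_of_eqOn_bdry (hM : IsOpen M) (hΩ : IsOpen Ω)
    (hs : ∀ p ∈ bdry M Ω, ∃ φ, IsDefiningAt Ω p φ) (hp : p ∈ bdry M Ω) {G : Eu n → ℝ}
    (hG : ContDiffAt ℝ 1 G p) (h : ∀ᶠ x in 𝓝 p, x ∈ bdry M Ω → G x = 0) {X : Eu n}
    (hX : X ∈ bdryTangent Ω p) : fderiv ℝ G p X = 0 := by
  obtain ⟨φ, U, hpU, hUM, hD, hb, -⟩ := exists_definingOn hM hΩ hs hp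
  have h0 := (hb p hpU).1 hp
  refine fderiv_apply_eq_zero_of_eq_zero_on_levelSet
    ((hD.smooth.contDiffAt (hD.isOpen.mem_nhds hpU)).of_le (by exact_mod_cast le_top))
    (hD.regular p hpU) h0 hG ?_ ?_
  · filter_upwards [h, hD.isOpen.mem_nhds hpU] with x hx hxU hx0 using hx ((hb x hxU).2 hx0)
  · rwa [(hD.isDefiningAt hpU h0).mem_bdryTangent_iff, hD.inner_unitGrad_eq_zero_iff hpU] at hX

/-- A normal vector is a multiple of any other nonzero normal vector. -/
lemma exists_eq_smul_of_isOutwardUnitNormal (hm : 0 < m)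
    (hs : ∀ p ∈ bdry (punctured n) Ω, ∃ φ, IsDefiningAt Ω p φ) (hp : p ∈ bdry (punctured n) Ω)
    {ν c : Eu n} (hν : IsOutwardUnitNormal (schwarzschild n m) Ω p ν) (hc : c ≠ 0)
    (hcperp : ∀ X ∈ bdryTangent Ω p, inner ℝ c X = 0) : ∃ s : ℝ, ν = s • c := by
  obtain ⟨φ, hφ⟩ := hs p hp
  obtain ⟨h0, U, hpU, hD⟩ := isDefiningAt_iff.1 hφ
  have hp0 : p ≠ 0 := hp.2
  have hL := (confL_pos (n := n) hm (norm_pos_iff.2 hp0)).ne'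
  have hνperp : ∀ X ∈ bdryTangent Ω p, inner ℝ ν X = 0 := by
    intro X hX
    have := hν.2.1 X hX
    rw [gInner_schwarzschild] at this
    exact (mul_eq_zero.1 this).resolve_left hL
  have hN1 := norm_unitGrad (hD.regular p hpU)
  have hmem := fun X => hφ.mem_bdryTangent_iff X
  set N := unitGrad φ p with hN
  have hpar : ∀ w : Eu n, (∀ X ∈ bdryTangent Ω p, inner ℝ w X = 0) → w = inner ℝ N w • N := by
    intro w hw
    have h1 : inner ℝ N (w - inner ℝ N w • N) = 0 := by
      rw [inner_sub_right, real_inner_smul_right, real_inner_self_eq_norm_sq, hN1]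
      ring
    have h2 : inner ℝ (w - inner ℝ N w • N) (w - inner ℝ N w • N) = 0 := by
      conv_lhs => rw [inner_sub_left, real_inner_smul_left, h1, hw _ ((hmem _).2 h1)]
      ring
    exact sub_eq_zero.1 (inner_self_eq_zero.1 h2)
  have hcN := hpar c hcperp
  have hcne : inner ℝ N c ≠ 0 := by
    intro h
    rw [h, zero_smul] at hcN
    exact hc hcN
  refine ⟨inner ℝ N ν / inner ℝ N c, ?_⟩
  calc ν = inner ℝ N ν • N := hpar ν hνperp
    _ = (inner ℝ N ν / inner ℝ N c) • inner ℝ N c • N := by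
      rw [smul_smul, div_mul_cancel₀ _ hcne]
    _ = (inner ℝ N ν / inner ℝ N c) • c := by rw [← hcN]

/-- `potV` is a static potential as soon as the boundary has, at each point, a normal `c x`
that depends smoothly on `x` and for which the boundary condition holds. -/
lemma isNonGeneric_of_normal (hn : 3 ≤ n) (hm : 0 < m)
    (hΩ : IsSmoothDomain (punctured n) (schwarzschild n m) Ω) {c : Eu n → Eu n}
    (hc : ContDiff ℝ ∞ c) (hc0 : ∀ p ∈ bdry (punctured n) Ω, c p ≠ 0)
    (hperp : ∀ p ∈ bdry (punctured n) Ω, ∀ X ∈ bdryTangent Ω p, inner ℝ (c p) X = 0)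
    (hcond : ∀ p ∈ bdry (punctured n) Ω, ∀ X Y,
      potV n m ‖p‖ * inner ℝ (fderiv ℝ c p X) Y
        = (potV' n m ‖p‖ - potV n m ‖p‖ * confP n m ‖p‖) * inner ℝ p (c p) * inner ℝ X Y) :
    IsNonGeneric (punctured n) (schwarzschild n m) Ω := by
  have hsub : Ω ∪ bdry (punctured n) Ω ⊆ punctured n :=
    Set.union_subset hΩ.subset fun x hx => hx.2
  refine ⟨hΩ, fun x => potV n m ‖x‖, ?_, ?_, ?_, ?_⟩
  · intro x hx
    have hx0 : x ≠ 0 := hsub hx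
    exact ((contDiffAt_potV hm (norm_pos_iff.2 hx0)).comp x
      (contDiffAt_norm ℝ hx0)).contDiffWithinAt
  · by_contra! hcon
    obtain ⟨x, hx⟩ := hΩ.isConnected.nonempty
    have hx0 : x ≠ 0 := hΩ.subset hx
    have hr := norm_pos_iff.2 hx0
    have h1 := hasFDerivAt_radial hx0 (hasDerivAt_potV hn hm hr)
    have h2 : (fun y : Eu n => potV n m ‖y‖) =ᶠ[𝓝 x] fun _ => (0 : ℝ) := by
      filter_upwards [hΩ.isOpen.mem_nhds hx] with y hy using hcon y (Or.inl hy)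
    have h3 := h1.unique ((hasFDerivAt_const (0 : ℝ) x).congr_of_eventuallyEq h2)
    have h4 := congrArg (fun L : Eu n →L[ℝ] ℝ => L x) h3
    simp only [smul_apply, innerSL_apply_apply, real_inner_self_eq_norm_sq, zero_apply,
      smul_eq_mul] at h4
    exact (mul_ne_zero (potV'_pos hn hm hr).ne' (pow_ne_zero 2 hr.ne')) h4
  · intro x hx
    exact (staticOp_eq_zero_iff hn hm (hΩ.subset hx) _).2 (hess_potV hn hm (hΩ.subset hx))
  · intro p hp ν hν X hX Y hY
    obtain ⟨V, hVo, hpV, hYs, hYt⟩ := hY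
    have hp0 : p ≠ 0 := hp.2
    have hYd := differentiableAt_of_contDiffOn hVo hYs hpV
    obtain ⟨s, rfl⟩ := exists_eq_smul_of_isOutwardUnitNormal hm hΩ.smooth_bdry hp hν (hc0 p hp)
      (hperp p hp)
    -- Differentiate `⟨c, Y⟩ = 0` along the boundary.
    have hG : ContDiffAt ℝ 1 (fun x => inner ℝ (c x) (Y x)) p :=
      (hc.contDiffAt.inner ℝ (hYs.contDiffAt (hVo.mem_nhds hpV))).of_le (by exact_mod_cast le_top)
    have h1 := fderiv_apply_eq_zero_of_eqOn_bdry isOpen_punctured hΩ.isOpen hΩ.smooth_bdry hp hG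
      (by filter_upwards [hVo.mem_nhds hpV] with x hxV hx using hperp x hx _ (hYt x ⟨hxV, hx⟩)) hX
    have h2 : HasFDerivAt (fun x => inner ℝ (c x) (Y x)) _ p :=
      (hc.contDiffAt.differentiableAt (by simp)).hasFDerivAt.inner ℝ hYd.hasFDerivAt
    rw [h2.fderiv] at h1
    simp only [ContinuousLinearMap.comp_apply, ContinuousLinearMap.prod_apply,
      fderivInnerCLM_apply] at h1
    rw [boundary_eq_iff (C := 1) hn hm (fun x _ => (one_mul _).symm) hp0 (Or.inr hp)
      (uniqueDiffWithinAt_union_bdry hΩ.smooth_bdry hp) hYd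
      (by rw [real_inner_smul_left, hperp p hp X hX, mul_zero])
      (by rw [real_inner_smul_left, hperp p hp _ (hYt p ⟨hpV, hp⟩), mul_zero])]
    rw [real_inner_smul_left, real_inner_smul_right]
    linear_combination s * potV n m ‖p‖ * h1 - s * hcond p hp X (Y p)

lemma isNonGeneric_of_bdry_subset_sphere (hn : 3 ≤ n) (hm : 0 < m)
    (hΩ : IsSmoothDomain (punctured n) (schwarzschild n m) Ω) {r : ℝ} (hr : 0 < r)
    (hrad : potV n m r ^ 2 = potV' n m r * r ^ 2)
    (hsub : bdry (punctured n) Ω ⊆ Metric.sphere 0 r) :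
    IsNonGeneric (punctured n) (schwarzschild n m) Ω := by
  refine isNonGeneric_of_normal hn hm hΩ (c := id) contDiff_id (fun p hp => hp.2) ?_ ?_
  · intro p hp X hX
    have hG : ContDiffAt ℝ 1 (fun x : Eu n => ‖x‖ ^ 2 - r ^ 2) p :=
      ((contDiff_norm_sq ℝ).sub contDiff_const).contDiffAt
    have h1 := fderiv_apply_eq_zero_of_eqOn_bdry isOpen_punctured hΩ.isOpen hΩ.smooth_bdry hp hG
      (Eventually.of_forall fun x hx => by
        rw [mem_sphere_zero_iff_norm.1 (hsub hx), sub_self]) hX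
    rw [((hasStrictFDerivAt_norm_sq p).hasFDerivAt.sub_const (r ^ 2)).fderiv] at h1
    simpa using h1
  · intro p hp X Y
    have hnorm := mem_sphere_zero_iff_norm.1 (hsub hp)
    rw [fderiv_id, hnorm]
    simp only [ContinuousLinearMap.id_apply, id, real_inner_self_eq_norm_sq, hnorm]
    have := one_add_confP_mul (n := n) hm hr
    linear_combination inner ℝ X Y * (hrad + potV n m r * this)

lemma isNonGeneric_of_bdry_subset_hyperplane (hn : 3 ≤ n) (hm : 0 < m)
    (hΩ : IsSmoothDomain (punctured n) (schwarzschild n m) Ω) {a : Eu n} (ha : a ≠ 0)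
    (hsub : bdry (punctured n) Ω ⊆ {x | inner ℝ a x = 0}) :
    IsNonGeneric (punctured n) (schwarzschild n m) Ω := by
  refine isNonGeneric_of_normal hn hm hΩ (c := fun _ => a) contDiff_const (fun p hp => ha) ?_ ?_
  · intro p hp X hX
    have hG : ContDiffAt ℝ 1 (fun x : Eu n => innerSL ℝ a x) p := (innerSL ℝ a).contDiff.contDiffAt
    have h1 := fderiv_apply_eq_zero_of_eqOn_bdry isOpen_punctured hΩ.isOpen hΩ.smooth_bdry hp hG
      (Eventually.of_forall fun x hx => hsub hx) hX
    rwa [(innerSL ℝ a).fderiv] at h1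
  · intro p hp X Y
    have : inner ℝ a p = 0 := hsub hp
    rw [real_inner_comm p a] at this
    simp [this]

lemma radius_pos (hn : 3 ≤ n) (hm : 0 < m) : 0 < radiusPlus n m ∧ 0 < radiusMinus n m := by
  have h3 : (3 : ℝ) ≤ n := by exact_mod_cast hn
  have hD0 : (0 : ℝ) ≤ (n : ℝ) ^ 2 - 2 * n := by nlinarith
  have hDsq : √((n : ℝ) ^ 2 - 2 * n) ^ 2 = (n : ℝ) ^ 2 - 2 * n := Real.sq_sqrt hD0
  have hDpos : 0 ≤ √((n : ℝ) ^ 2 - 2 * n) := Real.sqrt_nonneg _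
  have hDlt : √((n : ℝ) ^ 2 - 2 * n) < (n : ℝ) - 1 := by nlinarith
  exact ⟨Real.rpow_pos_of_pos (by nlinarith) _, Real.rpow_pos_of_pos (by nlinarith) _⟩

lemma IsCriticalSphere.exists_radius (hn : 3 ≤ n) (hm : 0 < m) {S : Set (Eu n)}
    (h : IsCriticalSphere m S) :
    ∃ r > 0, potV n m r ^ 2 = potV' n m r * r ^ 2 ∧ S = Metric.sphere 0 r := by
  obtain ⟨h1, h2⟩ := radius_pos hn hm
  rcases h with h | h
  · exact ⟨_, h1, (potV_sq_eq_iff hn hm h1).2 (Or.inl rfl), h⟩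
  · exact ⟨_, h2, (potV_sq_eq_iff hn hm h2).2 (Or.inr rfl), h⟩

lemma isNonGeneric_of_bdry (hn : 3 ≤ n) (hm : 0 < m)
    (hΩ : IsSmoothDomain (punctured n) (schwarzschild n m) Ω)
    (h : IsCriticalSphere m (bdry (punctured n) Ω) ∨ IsCentralHyperplane (bdry (punctured n) Ω)) :
    IsNonGeneric (punctured n) (schwarzschild n m) Ω := by
  rcases h with h | ⟨a, ha, h⟩
  · obtain ⟨r, hr, hrad, hS⟩ := h.exists_radius hn hm
    exact isNonGeneric_of_bdry_subset_sphere hn hm hΩ hr hrad hS.subset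
  · exact isNonGeneric_of_bdry_subset_hyperplane hn hm hΩ ha (h.subset.trans Set.inter_subset_left)

end

/-! ### Completeness and existence -/

section

open Filter Topology MeasureTheory

variable {n : ℕ} {m : ℝ} {M Ω U : Set (Eu n)} {p : Eu n} {φ : Eu n → ℝ}

/-- A function whose differential is bounded by the metric is Lipschitz for the intrinsic
distance. -/
lemma ofReal_mul_edist_le_gDist {G : Type*} [NormedAddCommGroup G] [NormedSpace ℝ G]
    {g : MetricField n} {S : Set (Eu n)} {F : Eu n → G} {K : ℝ} (hK : 0 ≤ K)
    (hF : ∀ x ∈ S, ContDiffAt ℝ 1 F x)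
    (hb : ∀ x ∈ S, ∀ v, K * ‖fderiv ℝ F x v‖ ≤ √(gInner g x v v)) (x y : Eu n) :
    ENNReal.ofReal K * edist (F x) (F y) ≤ gDist g S x y := by
  refine le_iInf₂ fun γ hγ => ?_
  obtain ⟨hγs, rfl, rfl, hγS⟩ := hγ
  have hFγ : ContDiffOn ℝ 1 (fun t => F (γ t)) (Set.Icc 0 1) := fun t ht =>
    (hF _ (hγS t ht)).comp_contDiffWithinAt t (hγs t ht)
  have h1 := enorm_sub_le_lintegral_deriv_of_contDiffOn_Icc hFγ zero_le_one
  rw [edist_comm, edist_eq_enorm_sub]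
  refine (mul_le_mul_right h1 _).trans ?_
  rw [← lintegral_const_mul' _ _ ENNReal.ofReal_ne_top, gLength]
  refine lintegral_mono_ae ?_
  rw [← restrict_Ioo_eq_restrict_Icc]
  filter_upwards [self_mem_ae_restrict measurableSet_Ioo] with t ht
  have ht' : t ∈ Set.Icc (0 : ℝ) 1 := ⟨ht.1.le, ht.2.le⟩
  have hγd : DifferentiableAt ℝ γ t :=
    ((hγs t ht').contDiffAt (Icc_mem_nhds ht.1 ht.2)).differentiableAt one_ne_zero
  have hd : HasDerivAt (fun t => F (γ t)) (fderiv ℝ F (γ t) (deriv γ t)) t :=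
    ((hF _ (hγS t ht')).differentiableAt one_ne_zero).hasFDerivAt.comp_hasDerivAt t
      hγd.hasDerivAt
  rw [hd.deriv, ← ofReal_norm, ← ENNReal.ofReal_mul hK]
  exact ENNReal.ofReal_le_ofReal (hb _ (hγS t ht') _)

lemma cauchySeq_of_gDist {G : Type*} [NormedAddCommGroup G] [NormedSpace ℝ G]
    {g : MetricField n} {S : Set (Eu n)} {F : Eu n → G} {K : ℝ} (hK : 0 < K)
    (hF : ∀ x ∈ S, ContDiffAt ℝ 1 F x)
    (hb : ∀ x ∈ S, ∀ v, K * ‖fderiv ℝ F x v‖ ≤ √(gInner g x v v)) {x : ℕ → Eu n}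
    (hx : ∀ ε : ENNReal, 0 < ε → ∃ N, ∀ k ≥ N, ∀ l ≥ N, gDist g S (x k) (x l) < ε) :
    CauchySeq fun k => F (x k) := by
  rw [EMetric.cauchySeq_iff]
  intro ε hε
  have hK0 : ENNReal.ofReal K ≠ 0 := by simpa using hK
  obtain ⟨N, hN⟩ := hx (ENNReal.ofReal K * ε) (ENNReal.mul_pos hK0 hε.ne')
  refine ⟨N, fun k hk l hl => ?_⟩
  have h1 := (ofReal_mul_edist_le_gDist hK.le hF hb (x k) (x l)).trans_lt (hN k hk l hl)
  exact (ENNReal.mul_lt_mul_iff_right hK0 ENNReal.ofReal_ne_top).1 h1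

lemma one_le_confL (hn : 3 ≤ n) (hm : 0 < m) {r : ℝ} (hr : 0 < r) : 1 ≤ confL n m r := by
  have h3 : (3 : ℝ) ≤ n := by exact_mod_cast hn
  refine Real.one_le_rpow ?_ (div_nonneg (by norm_num) (by linarith))
  have : 0 < m / (2 * r ^ (n - 2)) := by positivity
  linarith

/-- Near the origin the metric dominates a multiple of `|x|⁻⁴ δ`, the pullback of the Euclidean
metric under inversion. -/
lemma le_confL (hn : 3 ≤ n) (hm : 0 < m) {r : ℝ} (hr : 0 < r) :
    (m / 2) ^ (4 / ((n : ℝ) - 2)) / r ^ 4 ≤ confL n m r := by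
  have h3 : (3 : ℝ) ≤ n := by exact_mod_cast hn
  have h2 : (0 : ℝ) < n - 2 := by linarith
  have hcast : (n : ℝ) - 2 = ((n - 2 : ℕ) : ℝ) := by
    rw [Nat.cast_sub (by omega)]; norm_num
  have hpow : (r ^ (n - 2)) ^ (4 / ((n : ℝ) - 2)) = r ^ 4 := by
    rw [← Real.rpow_natCast, ← hcast, ← Real.rpow_mul hr.le, mul_div_cancel₀ _ h2.ne']
    exact_mod_cast Real.rpow_natCast r 4
  rw [← hpow, ← Real.div_rpow (by positivity) (by positivity), confL]
  refine Real.rpow_le_rpow (by positivity) ?_ (by positivity)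
  have hp : 0 < r ^ (n - 2) := by positivity
  have : m / 2 / r ^ (n - 2) = m / (2 * r ^ (n - 2)) := by field_simp
  linarith

lemma gInner_schwarzschild_self (x v : Eu n) :
    gInner (schwarzschild n m) x v v = confL n m ‖x‖ * ‖v‖ ^ 2 := by
  rw [gInner_schwarzschild, real_inner_self_eq_norm_sq]

/-- Sets that are closed in `ℝⁿ ∖ {0}` are complete: the coordinates and `1 / |x|` are Lipschitz, so
that a Cauchy sequence converges in `ℝⁿ`, and not to the origin. -/
lemma isGComplete_of_isClosed (hn : 3 ≤ n) (hm : 0 < m) {Z : Set (Eu n)} (hZ : IsClosed Z) :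
    IsGComplete (schwarzschild n m) (Z ∩ punctured n) := by
  intro x hxS hx
  have hne : ∀ k, x k ≠ 0 := fun k => (hxS k).2
  have hc1 : CauchySeq x := by
    refine cauchySeq_of_gDist (F := id) one_pos (fun y _ => contDiffAt_id) (fun y hy v => ?_) hx
    rw [fderiv_id, gInner_schwarzschild_self, one_mul]
    refine Real.le_sqrt_of_sq_le ?_
    have := one_le_confL hn hm (norm_pos_iff.2 hy.2)
    simp only [ContinuousLinearMap.id_apply]
    nlinarith [sq_nonneg ‖v‖]
  have hKpos : 0 < (m / 2) ^ (4 / ((n : ℝ) - 2)) := by positivity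
  have hc2 : CauchySeq fun k => ‖x k‖⁻¹ := by
    refine cauchySeq_of_gDist (F := fun y : Eu n => ‖y‖⁻¹) (Real.sqrt_pos.2 hKpos)
      (fun y hy => (contDiffAt_norm ℝ hy.2).inv (norm_ne_zero_iff.2 hy.2)) (fun y hy v => ?_) hx
    have hy0 : y ≠ 0 := hy.2
    have hr := norm_pos_iff.2 hy0
    have hd := hasFDerivAt_radial (h := fun r => r⁻¹) (a := -(‖y‖ ^ 3)⁻¹) hy0
      ((hasDerivAt_inv hr.ne').congr_deriv (by field_simp))
    rw [hd.fderiv, gInner_schwarzschild_self, Real.sqrt_mul (confL_pos hm hr).le,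
      Real.sqrt_sq (norm_nonneg v)]
    have h1 : √((m / 2) ^ (4 / ((n : ℝ) - 2))) / ‖y‖ ^ 2 ≤ √(confL n m ‖y‖) := by
      refine Real.le_sqrt_of_sq_le ?_
      rw [div_pow, Real.sq_sqrt hKpos.le]
      convert le_confL hn hm hr using 2
      ring
    have h2 : ‖(-(‖y‖ ^ 3)⁻¹ • innerSL ℝ y) v‖ ≤ (‖y‖ ^ 2)⁻¹ * ‖v‖ := by
      rw [smul_apply, innerSL_apply_apply, norm_smul, norm_neg, norm_inv, norm_pow, norm_norm]
      calc (‖y‖ ^ 3)⁻¹ * ‖inner ℝ y v‖ ≤ (‖y‖ ^ 3)⁻¹ * (‖y‖ * ‖v‖) := by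
            gcongr
            exact norm_inner_le_norm y v
        _ = (‖y‖ ^ 2)⁻¹ * ‖v‖ := by field_simp
    calc _ ≤ √((m / 2) ^ (4 / ((n : ℝ) - 2))) * ((‖y‖ ^ 2)⁻¹ * ‖v‖) := by gcongr
      _ = √((m / 2) ^ (4 / ((n : ℝ) - 2))) / ‖y‖ ^ 2 * ‖v‖ := by ring
      _ ≤ _ := by gcongr
  obtain ⟨p, hp⟩ := cauchySeq_tendsto_of_complete hc1
  obtain ⟨l, hl⟩ := cauchySeq_tendsto_of_complete hc2
  refine ⟨p, ⟨hZ.mem_of_tendsto hp (Eventually.of_forall fun k => (hxS k).1), ?_⟩, hp⟩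
  intro hp0
  have h1 := hp.norm.mul hl
  rw [hp0, norm_zero, zero_mul] at h1
  have h2 : (fun k => ‖x k‖ * ‖x k‖⁻¹) = fun _ => (1 : ℝ) := by
    funext k
    exact mul_inv_cancel₀ (norm_ne_zero_iff.2 (hne k))
  rw [h2] at h1
  exact zero_ne_one (tendsto_nhds_unique h1 tendsto_const_nhds)

lemma bdry_eq_of_definingOn (hΩ : IsOpen Ω) (hD : DefiningOn Ω M φ) :
    bdry M Ω = {x | φ x = 0} ∩ M := by
  ext x
  constructor
  · exact fun hx => ⟨(hD.mem_frontier_iff hΩ hx.2).1 hx.1, hx.2⟩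
  · exact fun hx => ⟨(hD.mem_frontier_iff hΩ hx.2).2 hx.1, hx.2⟩

/-- A connected sublevel set of a function that is regular on `ℝⁿ ∖ {0}` is a smooth domain. -/
lemma isSmoothDomain_of_definingOn (hn : 3 ≤ n) (hm : 0 < m) (hc : Continuous φ)
    (hsub : {x | φ x < 0} ⊆ punctured n) (hconn : IsConnected {x | φ x < 0})
    (hD : DefiningOn {x | φ x < 0} (punctured n) φ) :
    IsSmoothDomain (punctured n) (schwarzschild n m) {x | φ x < 0} := by
  have hopen : IsOpen {x | φ x < 0} := isOpen_lt hc continuous_const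
  have hb := bdry_eq_of_definingOn hopen hD
  refine ⟨hsub, hopen, hconn, fun p hp => ⟨φ, hD.isDefiningAt hp.2 ?_⟩, ?_⟩
  · rw [hb] at hp
    exact hp.1
  · have : {x | φ x < 0} ∪ bdry (punctured n) {x | φ x < 0} = {x | φ x ≤ 0} ∩ punctured n := by
      rw [hb]
      ext x
      constructor
      · rintro (hx | hx)
        · exact ⟨le_of_lt (show φ x < 0 from hx), hsub hx⟩
        · exact ⟨le_of_eq (show φ x = 0 from hx.1), hx.2⟩
      · rintro ⟨hx, hx0⟩
        rcases lt_or_eq_of_le (show φ x ≤ 0 from hx) with h | h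
        · exact Or.inl h
        · exact Or.inr ⟨h, hx0⟩
    rw [this]
    exact isGComplete_of_isClosed hn hm (isClosed_le hc continuous_const)

/-- The exterior of a centered sphere is a simple domain. -/
lemma exists_isSimpleDomain_sphere (hn : 3 ≤ n) (hm : 0 < m) {r : ℝ} (hr : 0 < r) :
    ∃ Ω : Set (Eu n), IsSimpleDomain (punctured n) (schwarzschild n m) Ω ∧
      bdry (punctured n) Ω = Metric.sphere 0 r := by
  set φ : Eu n → ℝ := fun x => r ^ 2 - ‖x‖ ^ 2 with hφ
  have hφs : ContDiff ℝ ∞ φ := contDiff_const.sub (contDiff_norm_sq ℝ)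
  have hset : {x | φ x < 0} = {x : Eu n | ‖x‖ ∈ Set.Ioi r} := by
    ext x
    change r ^ 2 - ‖x‖ ^ 2 < 0 ↔ r < ‖x‖
    rw [sub_neg, sq_lt_sq₀ hr.le (norm_nonneg x)]
  have hsub : {x | φ x < 0} ⊆ punctured n := by
    rw [hset]
    rintro x hx rfl
    have : r < ‖(0 : Eu n)‖ := hx
    rw [norm_zero] at this
    exact this.not_gt hr
  have hD : DefiningOn {x | φ x < 0} (punctured n) φ := by
    refine ⟨isOpen_punctured, hφs.contDiffOn, fun x hx h0 => ?_, fun x _ => Iff.rfl⟩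
    have hd := (hasStrictFDerivAt_norm_sq x).hasFDerivAt.const_sub (r ^ 2)
    rw [hd.fderiv] at h0
    have := congrArg (fun L : Eu n →L[ℝ] ℝ => L x) h0
    have hx0 : x ≠ 0 := hx
    simp at this
    exact hx0 this
  have hb : bdry (punctured n) {x | φ x < 0} = Metric.sphere 0 r := by
    rw [bdry_eq_of_definingOn (isOpen_lt hφs.continuous continuous_const) hD]
    ext x
    rw [mem_sphere_zero_iff_norm]
    constructor
    · rintro ⟨hx, -⟩
      have h1 : r ^ 2 - ‖x‖ ^ 2 = 0 := hx
      exact ((sq_eq_sq₀ hr.le (norm_nonneg x)).1 (sub_eq_zero.1 h1)).symm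
    · rintro rfl
      exact ⟨sub_self _, norm_pos_iff.1 hr⟩
  have hsphere := isConnected_sphere (one_lt_rank hn) (0 : Eu n) hr.le
  refine ⟨{x | φ x < 0}, ⟨isSmoothDomain_of_definingOn hn hm hφs.continuous hsub ⟨?_, ?_⟩ hD, ?_⟩, hb⟩
  · obtain ⟨x, hx⟩ := hsphere.nonempty
    refine ⟨(2 : ℝ) • x, ?_⟩
    rw [hset]
    change r < ‖(2 : ℝ) • x‖
    rw [norm_smul, mem_sphere_zero_iff_norm.1 hx]
    norm_num
    linarith
  · rw [hset]
    exact isPreconnected_norm_preimage hn isPreconnected_Ioi fun s hs => hr.trans hs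
  · rw [hb]
    exact hsphere

lemma isConnected_hyperplane_punctured (hn : 3 ≤ n) {a : Eu n} (ha : a ≠ 0) :
    IsConnected ({x | inner ℝ a x = 0} ∩ punctured n) := by
  set H : Submodule ℝ (Eu n) := (Submodule.span ℝ {a})ᗮ with hH
  have hrank : 1 < Module.rank ℝ H := by
    have h1 : Module.finrank ℝ (Submodule.span ℝ {a}) + Module.finrank ℝ H = n := by
      rw [Submodule.finrank_add_finrank_orthogonal, finrank_euclideanSpace_fin]
    rw [finrank_span_singleton ha] at h1
    rw [← Module.finrank_eq_rank]
    exact_mod_cast (by omega : 1 < Module.finrank ℝ H)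
  have him := (isConnected_compl_singleton_of_one_lt_rank hrank (0 : H)).image
    (Subtype.val : H → Eu n) continuous_subtype_val.continuousOn
  convert him using 1
  ext x
  simp only [Set.mem_image, Set.mem_compl_iff, Set.mem_singleton_iff, Subtype.exists, hH,
    Submodule.mem_orthogonal_singleton_iff_inner_right]
  constructor
  · rintro ⟨hx, hx0⟩
    exact ⟨x, hx, fun h => hx0 (congrArg Subtype.val h), rfl⟩
  · rintro ⟨y, hy, hy0, rfl⟩
    exact ⟨hy, fun h => hy0 (Subtype.ext h)⟩

/-- A half-space whose bounding hyperplane contains the origin is a simple domain. -/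
lemma exists_isSimpleDomain_hyperplane (hn : 3 ≤ n) (hm : 0 < m) {a : Eu n} (ha : a ≠ 0) :
    ∃ Ω : Set (Eu n), IsSimpleDomain (punctured n) (schwarzschild n m) Ω ∧
      bdry (punctured n) Ω = {x | inner ℝ a x = 0} ∩ punctured n := by
  have haa : 0 < inner ℝ a a := real_inner_self_pos.2 ha
  set φ : Eu n → ℝ := fun x => innerSL ℝ a x with hφ
  have hφs : ContDiff ℝ ∞ φ := (innerSL ℝ a).contDiff
  have hsub : {x | φ x < 0} ⊆ punctured n := by
    rintro x hx rfl
    have : φ 0 < 0 := hx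
    simp [hφ] at this
  have hD : DefiningOn {x | φ x < 0} (punctured n) φ := by
    refine ⟨isOpen_punctured, hφs.contDiffOn, fun x hx h0 => ?_, fun x _ => Iff.rfl⟩
    rw [hφ, (innerSL ℝ a).fderiv] at h0
    have := congrArg (fun L : Eu n →L[ℝ] ℝ => L a) h0
    simp only [innerSL_apply_apply, zero_apply] at this
    exact haa.ne' this
  have hb := bdry_eq_of_definingOn (isOpen_lt hφs.continuous continuous_const) hD
  refine ⟨{x | φ x < 0}, ⟨isSmoothDomain_of_definingOn hn hm hφs.continuous hsub ⟨?_, ?_⟩ hD, ?_⟩, hb⟩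
  · refine ⟨-a, ?_⟩
    change inner ℝ a (-a) < 0
    rw [inner_neg_right]
    linarith
  · exact (convex_halfSpace_lt (innerSL ℝ a).toLinearMap.isLinear 0).isPreconnected
  · rw [hb]
    exact isConnected_hyperplane_punctured hn ha

end

end StaticBdry

end

theorem mainTheorem4 (n : ℕ) (hn : 3 ≤ n) (m : ℝ) (hm : 0 < m) :
    (∀ Ω : Set (StaticBdry.Eu n),
      StaticBdry.IsSimpleDomain (StaticBdry.punctured n) (StaticBdry.schwarzschild n m) Ω →
        (StaticBdry.IsNonGeneric (StaticBdry.punctured n) (StaticBdry.schwarzschild n m) Ω ↔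
          StaticBdry.IsCriticalSphere m (StaticBdry.bdry (StaticBdry.punctured n) Ω) ∨
          StaticBdry.IsCentralHyperplane (StaticBdry.bdry (StaticBdry.punctured n) Ω))) ∧
    (∀ S : Set (StaticBdry.Eu n),
      StaticBdry.IsCriticalSphere m S ∨ StaticBdry.IsCentralHyperplane S →
        ∃ Ω : Set (StaticBdry.Eu n),
          StaticBdry.IsSimpleDomain (StaticBdry.punctured n) (StaticBdry.schwarzschild n m) Ω ∧
          StaticBdry.IsNonGeneric (StaticBdry.punctured n) (StaticBdry.schwarzschild n m) Ω ∧
          StaticBdry.bdry (StaticBdry.punctured n) Ω = S) := by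
  constructor
  · intro Ω hΩ
    exact ⟨StaticBdry.bdry_of_isNonGeneric hn hm hΩ.2,
      StaticBdry.isNonGeneric_of_bdry hn hm hΩ.1⟩
  · intro S hS
    obtain ⟨Ω, hΩ, hb⟩ : ∃ Ω : Set (StaticBdry.Eu n),
        StaticBdry.IsSimpleDomain (StaticBdry.punctured n) (StaticBdry.schwarzschild n m) Ω ∧
          StaticBdry.bdry (StaticBdry.punctured n) Ω = S := by
      rcases hS with h | ⟨a, ha, rfl⟩
      · obtain ⟨r, hr, -, rfl⟩ := h.exists_radius hn hm
        exact StaticBdry.exists_isSimpleDomain_sphere hn hm hr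
      · exact StaticBdry.exists_isSimpleDomain_hyperplane hn hm ha
    rw [← hb] at hS
    exact ⟨Ω, hΩ, StaticBdry.isNonGeneric_of_bdry hn hm hΩ.1 hS, hb⟩
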